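/- **Completeness of the many-sorted polyadic hybrid logic $\mathcal H_\Sigma(\forall)$.** *Language.* Let $(S,\Sigma)$ be a many-sorted signature, with symbols $\sigma\in\Sigma_{s_1\cdots s_n,s}$ ($n\ge 0$), and let $\mathrm{PROP}_s\neq\emptyset$, $\mathrm{NOM}_s$, $\mathrm{SVAR}_s$ ($s\in S$) be pairwise disjoint sets of propositional variables, nominals and state variables. The language is countable (i.e. $S$, $\Sigma$ and all these sets are countable), and each $\mathrm{SVAR}_s$ is infinite. A state symbol is a nominal or a state variable. The formulas of sort $s$ are $$\phi_s ::= p\mid j\mid y\mid \neg\phi_s\mid \phi_s\vee\phi_s\mid \sigma(\phi_{s_1},\dots,\phi_{s_n})\mid \forall x\,\phi_s$$ with $p\in\mathrm{PROP}_s$, $j\in\mathrm{NOM}_s$, $y\in\mathrm{SVAR}_s$, $\sigma\in\Sigma_{s_1\cdots s_n,s}$, and $x$ a state variable of any sort. Further connectives are defined as usual, with $\top_s := p\vee\neg p$ for a fixed $p\in \mathrm{PROP}_s$, $\bot_s:=\neg\top_s$, $\exists x\,\phi:=\neg\forall x\,\neg\phi$ and $\sigma^{\Box}(\phi_1,\dots,\phi_n):=\neg\sigma(\neg\phi_1,\dots,\neg\phi_n)$.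 *Semantics.* A model consists of nonempty sets $W_s$ ($s\in S$), relations $R_\sigma\subseteq W_s\times W_{s_1}\times\cdots\times W_{s_n}$ for $\sigma\in\Sigma_{s_1\cdots s_n,s}$, sets $V_s(p)\subseteq W_s$ for $p\in \mathrm{PROP}_s$, and singletons $V_s(j)\subseteq W_s$ for $j\in\mathrm{NOM}_s$. An assignment is a sorted map $g:\mathrm{SVAR}\to W$. Satisfaction $\mathcal M,g,w\models\phi$ (for $w\in W_s$ and $\phi$ of sort $s$) is defined by: $w\in V_s(a)$ for $a$ a propositional variable or nominal; $w=g_s(x)$ for a state variable $x$; the usual clauses for $\neg,\vee$; $\mathcal M,g,w\models\sigma(\phi_1,\dots,\phi_n)$ iff there are $w_i\in W_{s_i}$ with $R_\sigma w w_1\dots w_n$ and $\mathcal M,g,w_i\models\phi_i$ for all $i$; $\mathcal M,g,w\models\forall x\,\phi$ iff $\mathcal M,g',w\models\phi$ for all $g'$ that differ from $g$ at most at $x$. *Contexts.* Let $\#_t$ be a new placeholder of each sort $t$. $NC=\{NC_s\}_s$ is the least family with $\#_s,\top_s\in NC_s$ and $\sigma(\eta_1,\dots,\eta_n)\in NC_s$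 whenever $\sigma\in\Sigma_{s_1\cdots s_n,s}$ and $\eta_i\in NC_{s_i}$. $NomC_s$ is the set of those $\eta\in NC_s$ in which exactly one of the symbols $\#_t$ ($t\in S$) occurs (possibly several times); then $\eta(\phi):=\eta[\phi/\#_t]$ and $\eta^{\Box}(\phi):=\neg\eta(\neg\phi)$ for $\phi$ of sort $t$. *Deductive system.* $\vdash_s\phi$ is the least family of sets of formulas of sort $s\in S$ that contains, for formulas and state variables of appropriate sorts, all instances of propositional tautologies and - $(K_\sigma)$ $\sigma^{\Box}(\dots,\phi\to\chi,\dots)\to(\sigma^{\Box}(\dots,\phi,\dots)\to\sigma^{\Box}(\dots,\chi,\dots))$, where the three formulas agree in the other arguments; - $(Dual_\sigma)$ $\sigma(\phi_1,\dots,\phi_n)\leftrightarrow\neg\sigma^{\Box}(\neg\phi_1,\dots,\neg\phi_n)$; - $(Q1)$ $\forall x(\phi\to\psi)\to(\phi\to\forall x\,\psi)$, where $x$ is not free in $\phi$; - $(Q2)$ $\forall x\,\phi\to\phi[z/x]$, where $z$ is a state symbol of the sort of $x$ that is substitutable for $x$ in $\phi$; - $(Name)$ $\exists x\,x$; - $(Barcan)$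 $\forall x\,\sigma^{\Box}(\phi_1,\dots,\phi_n)\to\sigma^{\Box}(\phi_1,\dots,\forall x\,\phi_i,\dots,\phi_n)$, where $x$ is not free in $\phi_k$ for $k\neq i$; - $(Nom)$ $\forall x\,[\eta(x\wedge\phi)\to\theta^{\Box}(x\to\phi)]$, where $\eta,\theta\in NomC_s$ have the same placeholder $\#_t$ and $x$ and $\phi$ are of sort $t$; and is closed under $(MP)$; under $(UG)$: from $\vdash_{s_i}\phi_i$ infer $\vdash_s\sigma^{\Box}(\phi_1,\dots,\phi_n)$; and under $(Gen)$: from $\vdash_s\phi$ infer $\vdash_s\forall x\,\phi$. A set $\Gamma$ of formulas of sort $s$ is *consistent* if there are no $\gamma_1,\dots,\gamma_m\in\Gamma$ ($m\ge 0$) with $\vdash_s\gamma_1\wedge\cdots\wedge\gamma_m\to\bot_s$. It is *satisfiable* if there are a model $\mathcal M$, an assignment $g$ and $w\in W_s$ with $\mathcal M,g,w\models\phi$ for all $\phi\in\Gamma$. **Theorem.** For every sort $s$, every consistent set $\Gamma$ of formulas of sort $s$ of $\mathcal H_\Sigma(\forall)$ is satisfiable. -/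

import Mathlib

universe u

namespace HybridForall

/-- A many-sorted signature `(S, Σ)` with sorted families of propositional variables, nominals and
state variables. `Op [s₁, …, sₙ] s` is the set of symbols `σ : s₁ ⋯ sₙ → s`. Since the families are
indexed by the sort, symbols of distinct sorts are distinct. -/
structure Language where
  /-- the sorts -/
  S : Type u
  /-- the operation symbols -/
  Op : List S → S → Type u
  /-- the propositional variables -/
  PROP : S → Type u
  /-- the nominals -/
  NOM : S → Type u
  /-- the state variables -/
  SVAR : S → Type u
  /-- there is a propositional variable of each sort -/
  prop_nonempty : ∀ s, Nonempty (PROP s)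

/-- The language is countable. -/
structure Language.IsCountable (L : Language.{u}) : Prop where
  sorts : Countable L.S
  ops : ∀ l s, Countable (L.Op l s)
  props : ∀ s, Countable (L.PROP s)
  noms : ∀ s, Countable (L.NOM s)
  svars : ∀ s, Countable (L.SVAR s)

variable {L : Language.{u}}

/-- State variables of arbitrary sort. -/
abbrev AnyVar (L : Language.{u}) : Type u := Σ s : L.S, L.SVAR s

/-- State symbols of sort `s`: nominals and state variables. -/
inductive StateSymbol (L : Language.{u}) (s : L.S) : Type u
  | nom (j : L.NOM s) : StateSymbol L s
  | var (x : L.SVAR s) : StateSymbol L s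

/-- The formulas of sort `s`. -/
inductive Form (L : Language.{u}) : L.S → Type u
  | prop {s : L.S} (p : L.PROP s) : Form L s
  | nom {s : L.S} (j : L.NOM s) : Form L s
  | svar {s : L.S} (x : L.SVAR s) : Form L s
  | neg {s : L.S} (φ : Form L s) : Form L s
  | or {s : L.S} (φ ψ : Form L s) : Form L s
  | app {l : List L.S} {s : L.S} (σ : L.Op l s)
      (φ : ∀ i : Fin l.length, Form L (l.get i)) : Form L s
  | all {s t : L.S} (x : L.SVAR t) (φ : Form L s) : Form L s

namespace Form

def imp {s : L.S} (φ ψ : Form L s) : Form L s := or (neg φ) ψ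

def and {s : L.S} (φ ψ : Form L s) : Form L s := neg (or (neg φ) (neg ψ))

def iff {s : L.S} (φ ψ : Form L s) : Form L s := and (imp φ ψ) (imp ψ φ)

/-- `⊤ₛ` is `p ∨ ¬ p` for a fixed propositional variable `p` of sort `s`. -/
noncomputable def top (s : L.S) : Form L s :=
  or (prop (Classical.choice (L.prop_nonempty s)))
    (neg (prop (Classical.choice (L.prop_nonempty s))))

noncomputable def bot (s : L.S) : Form L s := neg (top s)

/-- The dual binder `∃`. -/
def ex {s t : L.S} (x : L.SVAR t) (φ : Form L s) : Form L s := neg (all x (neg φ))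

/-- The dual operation `σ^□`. -/
def box {l : List L.S} {s : L.S} (σ : L.Op l s) (φ : ∀ i : Fin l.length, Form L (l.get i)) :
    Form L s :=
  neg (app σ fun i => neg (φ i))

/-- Finite conjunctions. -/
noncomputable def conj {s : L.S} : List (Form L s) → Form L s
  | [] => top s
  | φ :: l => and φ (conj l)

/-- The state variable `v` has a free occurrence in the formula. -/
def IsFree (v : AnyVar L) : {s : L.S} → Form L s → Prop
  | _, prop _ => False
  | _, nom _ => False
  | s, svar y => v = ⟨s, y⟩
  | _, neg φ => IsFree v φ
  | _, or φ ψ => IsFree v φ ∨ IsFree v ψ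
  | _, app _ φ => ∃ i, IsFree v (φ i)
  | _, all (t := t) y φ => v ≠ ⟨t, y⟩ ∧ IsFree v φ

/-- A state symbol as a formula. -/
def ofSymbol {s : L.S} : StateSymbol L s → Form L s
  | StateSymbol.nom j => nom j
  | StateSymbol.var x => svar x

/-- The state symbol `z` is substitutable for `x` in the formula: no free occurrence of `x` is in the
scope of a quantifier binding `z`. (A nominal is always substitutable.) -/
def Substitutable {t : L.S} (x : L.SVAR t) (z : StateSymbol L t) : {s : L.S} → Form L s → Prop
  | _, prop _ => True
  | _, nom _ => True
  | _, svar _ => True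
  | _, neg φ => Substitutable x z φ
  | _, or φ ψ => Substitutable x z φ ∧ Substitutable x z ψ
  | _, app _ φ => ∀ i, Substitutable x z (φ i)
  | _, all (t := r) y φ =>
      ¬ IsFree ⟨t, x⟩ (all y φ) ∨
        ((∀ y' : L.SVAR t, z = StateSymbol.var y' → (⟨t, y'⟩ : AnyVar L) ≠ ⟨r, y⟩) ∧
          Substitutable x z φ)

open Classical in
/-- `φ[z/x]`: the free occurrences of `x` are replaced by `z`. -/
noncomputable def subst {t : L.S} (x : L.SVAR t) (z : StateSymbol L t) :
    {s : L.S} → Form L s → Form L s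
  | _, prop p => prop p
  | _, nom j => nom j
  | s, svar y =>
      ofSymbol (Function.update (fun v : AnyVar L => StateSymbol.var v.2) ⟨t, x⟩ z ⟨s, y⟩)
  | _, neg φ => neg (subst x z φ)
  | _, or φ ψ => or (subst x z φ) (subst x z ψ)
  | _, app σ φ => app σ fun i => subst x z (φ i)
  | _, all (t := r) y φ =>
      if (⟨r, y⟩ : AnyVar L) = ⟨t, x⟩ then all y φ else all y (subst x z φ)

/-- `φ` is an instance of a propositional tautology: it holds under every valuation of the formulas
of its sort that respects `¬` and `∨`. -/
def IsTautology {s : L.S} (φ : Form L s) : Prop :=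
  ∀ v : Form L s → Prop, (∀ ψ, v (neg ψ) ↔ ¬ v ψ) → (∀ ψ χ, v (or ψ χ) ↔ (v ψ ∨ v χ)) → v φ

end Form

open Form

/-- `NC L t s` is the set of those elements of `NCₛ` in which no placeholder other than `#ₜ`
occurs. -/
inductive NC (L : Language.{u}) (t : L.S) : L.S → Type u
  | hole : NC L t t
  | top (s : L.S) : NC L t s
  | app {l : List L.S} {s : L.S} (σ : L.Op l s) (η : ∀ i : Fin l.length, NC L t (l.get i)) :
      NC L t s

namespace NC

/-- The placeholder occurs in `η`. The elements of `NomCₛ` are the `η : NC L t s`, `t` a sort, with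
`η.HasHole`. -/
def HasHole {t : L.S} : {s : L.S} → NC L t s → Prop
  | _, hole => True
  | _, top _ => False
  | _, app _ η => ∃ i, HasHole (η i)

/-- `η(φ) = η[φ/#ₜ]`. -/
noncomputable def fill {t : L.S} (φ : Form L t) : {s : L.S} → NC L t s → Form L s
  | _, hole => φ
  | _, top s => Form.top s
  | _, app σ η => Form.app σ fun i => fill φ (η i)

/-- The dual `η^□(φ) = ¬ η(¬ φ)`. -/
noncomputable def fillBox {t : L.S} (φ : Form L t) {s : L.S} (η : NC L t s) : Form L s :=
  neg (fill (neg φ) η)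

end NC

/-- `⊢ₛ φ`: the theorems of the deductive system. -/
inductive Provable : {s : L.S} → Form L s → Prop
  | taut {s : L.S} (φ : Form L s) (h : IsTautology φ) : Provable φ
  | K {l : List L.S} {s : L.S} (σ : L.Op l s) (φ : ∀ i : Fin l.length, Form L (l.get i))
      (i : Fin l.length) (ψ χ : Form L (l.get i)) :
      Provable (imp (box σ (Function.update φ i (imp ψ χ)))
        (imp (box σ (Function.update φ i ψ)) (box σ (Function.update φ i χ))))
  | dual {l : List L.S} {s : L.S} (σ : L.Op l s) (φ : ∀ i : Fin l.length, Form L (l.get i)) :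
      Provable (iff (app σ φ) (neg (box σ fun i => neg (φ i))))
  | Q1 {s t : L.S} (x : L.SVAR t) (φ ψ : Form L s) (h : ¬ IsFree ⟨t, x⟩ φ) :
      Provable (imp (all x (imp φ ψ)) (imp φ (all x ψ)))
  | Q2 {s t : L.S} (x : L.SVAR t) (z : StateSymbol L t) (φ : Form L s)
      (h : Substitutable x z φ) :
      Provable (imp (all x φ) (subst x z φ))
  | name {t : L.S} (x : L.SVAR t) : Provable (ex x (svar x))
  | barcan {l : List L.S} {s t : L.S} (σ : L.Op l s) (x : L.SVAR t)
      (φ : ∀ i : Fin l.length, Form L (l.get i)) (i : Fin l.length)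
      (h : ∀ k, k ≠ i → ¬ IsFree ⟨t, x⟩ (φ k)) :
      Provable (imp (all x (box σ φ)) (box σ (Function.update φ i (all x (φ i)))))
  | nom {s t : L.S} (η θ : NC L t s) (hη : η.HasHole) (hθ : θ.HasHole) (x : L.SVAR t)
      (φ : Form L t) :
      Provable (all x (imp (η.fill (and (svar x) φ)) (θ.fillBox (imp (svar x) φ))))
  | mp {s : L.S} {φ ψ : Form L s} (h₁ : Provable φ) (h₂ : Provable (imp φ ψ)) : Provable ψ
  | ug {l : List L.S} {s : L.S} (σ : L.Op l s) (φ : ∀ i : Fin l.length, Form L (l.get i))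
      (i : Fin l.length) (h : Provable (φ i)) : Provable (box σ φ)
  | gen {s t : L.S} (x : L.SVAR t) {φ : Form L s} (h : Provable φ) : Provable (all x φ)

/-- `Γ ⊢ₛ φ` (local deduction): `⊢ₛ γ₁ ∧ ⋯ ∧ γₙ → φ` for some `γ₁, …, γₙ ∈ Γ`. -/
def Derives {s : L.S} (Γ : Set (Form L s)) (φ : Form L s) : Prop :=
  ∃ l : List (Form L s), (∀ γ ∈ l, γ ∈ Γ) ∧ Provable (imp (conj l) φ)

/-- A set of formulas of sort `s` is consistent if it does not derive `⊥ₛ`. -/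
def Consistent {s : L.S} (Γ : Set (Form L s)) : Prop := ¬ Derives Γ (bot s)

/-- (Standard) models: nominals are evaluated as singletons. -/
structure Model (L : Language.{u}) where
  /-- the worlds -/
  W : L.S → Type u
  nonempty : ∀ s, Nonempty (W s)
  /-- the relations `R_σ ⊆ Wₛ × Wₛ₁ × ⋯ × Wₛₙ` -/
  R : ∀ {l : List L.S} {s : L.S}, L.Op l s → W s → (∀ i : Fin l.length, W (l.get i)) → Prop
  /-- the valuation of propositional variables -/
  V : ∀ {s : L.S}, L.PROP s → Set (W s)
  /-- the valuation of nominals -/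
  VNom : ∀ {s : L.S}, L.NOM s → Set (W s)
  singleton : ∀ {s : L.S} (j : L.NOM s), ∃ w, VNom j = {w}

/-- Sorted functions from the state variables to the worlds. -/
abbrev Assignment (M : Model L) : Type u := ∀ v : AnyVar L, M.W v.1

/-- `g'` is an `x`-variant of `g`. -/
def IsVariant {M : Model L} {t : L.S} (x : L.SVAR t) (g' g : Assignment M) : Prop :=
  ∀ v : AnyVar L, v ≠ ⟨t, x⟩ → g' v = g v

/-- The satisfaction relation `M, g, w ⊨ₛ φ`. -/
def Sat (M : Model L) : {s : L.S} → Assignment M → M.W s → Form L s → Prop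
  | _, _, w, prop p => w ∈ M.V p
  | _, _, w, nom j => w ∈ M.VNom j
  | s, g, w, svar x => w = g ⟨s, x⟩
  | _, g, w, neg φ => ¬ Sat M g w φ
  | _, g, w, Form.or φ ψ => Sat M g w φ ∨ Sat M g w ψ
  | _, g, w, app (l := l) σ φ =>
      ∃ u : ∀ i : Fin l.length, M.W (l.get i), M.R σ w u ∧ ∀ i, Sat M g (u i) (φ i)
  | _, g, w, all x φ => ∀ g' : Assignment M, IsVariant x g' g → Sat M g' w φ

/-- A set of formulas of sort `s` is satisfiable if all its members hold together at some world of
sort `s` of some model under some assignment. -/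
def Satisfiable {s : L.S} (Γ : Set (Form L s)) : Prop :=
  ∃ (M : Model L) (g : Assignment M) (w : M.W s), ∀ φ ∈ Γ, Sat M g w φ

end HybridForall

/-! A Henkin construction in which a single maximal consistent set describes the whole model. Extend
Γ to a maximal consistent set A containing a variable witness for each of its existential members
(`exists_ultra`). For a state symbol z, let `World A z` collect all φ such that η(z ∧ φ) ∈ A for
some linear context η.

The axiom Nom makes this coherent: if η(z ∧ φ) ∈ A, then θ(z ∧ ¬φ) ∉ A for every θ, so all contexts
reaching z agree on what holds there. As contexts also distribute over ∨, every nonempty `World A z`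
is maximal consistent (`ultra_world`), and it equals `World A z'` as soon as it contains z'
(`world_eq_of_mem`). Barcan pulls ∃ out of contexts, so the witnesses in A alone serve every world
(`world_witness`); with Name they yield named successors for σ-formulas (`world_successor`). The
truth lemma `sat_canonical_iff` identifies satisfaction with membership at the nonempty worlds. By
Name and its witness some variable y lies in A, hence Γ ⊆ A ⊆ `World A y`.

Two points concern variables. Witnesses must be fresh although Γ may use every variable, so Γ is
first renamed into a co-infinite set of variables (`exists_rename_consistent`). And Q2 applies only
to substitutable symbols, so bound variables are renamed where necessary (`exists_alpha`). -/

namespace HybridForall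

variable {L : Language.{u}}

open Form

namespace Form

/-! ### Occurrences, depth, countability -/

/-- The state variable `v` occurs in the formula, free, bound or as the variable of a quantifier. -/
def Occurs (v : AnyVar L) : {s : L.S} → Form L s → Prop
  | _, prop _ => False
  | _, nom _ => False
  | s, svar y => v = ⟨s, y⟩
  | _, neg φ => Occurs v φ
  | _, or φ ψ => Occurs v φ ∨ Occurs v ψ
  | _, app _ φ => ∃ i, Occurs v (φ i)
  | _, all (t := t) y φ => v = ⟨t, y⟩ ∨ Occurs v φ

/-- The state variable `v` is quantified somewhere in the formula. -/
def IsBound (v : AnyVar L) : {s : L.S} → Form L s → Prop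
  | _, prop _ => False
  | _, nom _ => False
  | _, svar _ => False
  | _, neg φ => IsBound v φ
  | _, or φ ψ => IsBound v φ ∨ IsBound v ψ
  | _, app _ φ => ∃ i, IsBound v (φ i)
  | _, all (t := t) y φ => v = ⟨t, y⟩ ∨ IsBound v φ

theorem finite_occurs {s : L.S} (φ : Form L s) : {v | Occurs v φ}.Finite := by
  induction φ with
  | prop p => simp [Occurs]
  | nom j => simp [Occurs]
  | svar x => simp [Occurs]
  | neg φ ih => simpa only [Occurs] using ih
  | or φ ψ ih₁ ih₂ => simpa only [Occurs, Set.ofPred_or] using ih₁.union ih₂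
  | app σ φ ih =>
    simp only [Occurs, Set.ofPred_exists]
    exact Set.finite_iUnion ih
  | all x φ ih =>
    simp only [Occurs, Set.ofPred_or]
    exact (by simp : ({v | v = _} : Set (AnyVar L)).Finite).union ih

theorem IsFree.occurs {v : AnyVar L} {s : L.S} {φ : Form L s} (h : IsFree v φ) : Occurs v φ := by
  induction φ with
  | prop p => exact h
  | nom j => exact h
  | svar x => exact h
  | neg φ ih => exact ih h
  | or φ ψ ih₁ ih₂ => exact Or.imp ih₁ ih₂ h
  | app σ φ ih => exact h.imp fun i => ih i
  | all x φ ih => exact Or.inr (ih h.2)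

theorem IsBound.occurs {v : AnyVar L} {s : L.S} {φ : Form L s} (h : IsBound v φ) :
    Occurs v φ := by
  induction φ with
  | prop p => exact h
  | nom j => exact h
  | svar x => exact h.elim
  | neg φ ih => exact ih h
  | or φ ψ ih₁ ih₂ => exact Or.imp ih₁ ih₂ h
  | app σ φ ih => exact h.imp fun i => ih i
  | all x φ ih => exact Or.imp id ih h

theorem exists_not_occurs {t : L.S} {X : Set (L.SVAR t)} (hX : X.Infinite) {F : Set (AnyVar L)}
    (hF : F.Finite) : ∃ x ∈ X, (⟨t, x⟩ : AnyVar L) ∉ F := by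
  have hfin : ((Sigma.mk t : L.SVAR t → AnyVar L) ⁻¹' F).Finite :=
    hF.preimage sigma_mk_injective.injOn
  obtain ⟨x, hx, hxF⟩ := hX.exists_notMem_finite hfin
  exact ⟨x, hx, hxF⟩

/-- The depth of a formula. -/
noncomputable def depth : {s : L.S} → Form L s → ℕ
  | _, prop _ => 0
  | _, nom _ => 0
  | _, svar _ => 0
  | _, neg φ => depth φ + 1
  | _, or φ ψ => max (depth φ) (depth ψ) + 1
  | _, app _ φ => (Finset.univ.sup fun i => depth (φ i)) + 1
  | _, all _ φ => depth φ + 1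

theorem depth_lt_app {l : List L.S} {s : L.S} (σ : L.Op l s)
    (φ : ∀ i : Fin l.length, Form L (l.get i)) (i : Fin l.length) :
    depth (φ i) < depth (app σ φ) :=
  Nat.lt_succ_of_le (Finset.le_sup (f := fun i => depth (φ i)) (Finset.mem_univ i))

/-- Each constructor applied to formulas of smaller depth gives a countable set; for `app` this uses
that arities are finite, so that the product of the argument sets is countable. -/
theorem countable_depth_lt (hc : L.IsCountable) (n : ℕ) (s : L.S) :
    {φ : Form L s | depth φ < n}.Countable := by
  have := hc.sorts
  have := hc.ops
  have := hc.props
  have := hc.noms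
  have := hc.svars
  induction n generalizing s with
  | zero => simp
  | succ n ih =>
    refine Set.Countable.mono ?_ ((Set.countable_range (prop (L := L) (s := s))).union
      ((Set.countable_range (nom (L := L) (s := s))).union
      ((Set.countable_range (svar (L := L) (s := s))).union
      (((ih s).image neg).union
      (((ih s).image2 (ih s) or).union
      ((Set.countable_iUnion fun l : List L.S => Set.countable_iUnion fun σ : L.Op l s =>
          (Set.countable_univ_pi fun i => ih (l.get i)).image (app σ)).union
      (Set.countable_iUnion fun v : AnyVar L => (ih s).image (all v.2))))))))
    intro φ hφ
    cases φ with
    | prop p => exact .inl ⟨p, rfl⟩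
    | nom j => exact .inr (.inl ⟨j, rfl⟩)
    | svar x => exact .inr (.inr (.inl ⟨x, rfl⟩))
    | neg φ => exact .inr (.inr (.inr (.inl ⟨φ, Nat.lt_of_succ_lt_succ hφ, rfl⟩)))
    | or φ ψ =>
      have h := max_lt_iff.1 (Nat.lt_of_succ_lt_succ hφ)
      exact .inr (.inr (.inr (.inr (.inl ⟨φ, h.1, ψ, h.2, rfl⟩))))
    | @app l _ σ φ =>
      refine .inr (.inr (.inr (.inr (.inr (.inl
        (Set.mem_iUnion.2 ⟨l, Set.mem_iUnion.2 ⟨σ, φ, fun i _ => ?_, rfl⟩⟩))))))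
      exact (depth_lt_app σ φ i).trans_le (Nat.le_of_lt_succ hφ)
    | @all _ t x φ =>
      exact .inr (.inr (.inr (.inr (.inr (.inr
        (Set.mem_iUnion.2 ⟨⟨t, x⟩, φ, Nat.lt_of_succ_lt_succ hφ, rfl⟩))))))

theorem countable_form (hc : L.IsCountable) (s : L.S) : Countable (Form L s) := by
  rw [← Set.countable_univ_iff]
  refine (Set.countable_iUnion fun n => countable_depth_lt hc n s).mono fun φ _ => ?_
  exact Set.mem_iUnion.2 ⟨depth φ + 1, Nat.lt_succ_self _⟩

/-! ### Substitution -/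

section Subst

variable {s t : L.S} {x : L.SVAR t} {z : StateSymbol L t}

@[simp] theorem subst_svar_self : subst x z (svar x) = ofSymbol z := by
  simp [subst]

theorem subst_svar_of_ne {r : L.S} {y : L.SVAR r} (h : (⟨r, y⟩ : AnyVar L) ≠ ⟨t, x⟩) :
    subst x z (svar y) = svar y := by
  classical
  rw [subst, Function.update_of_ne h]
  rfl

theorem subst_all_self {φ : Form L s} : subst x z (all x φ) = all x φ := by
  simp [subst]

theorem subst_all_of_ne {r : L.S} {y : L.SVAR r} {φ : Form L s}
    (h : (⟨r, y⟩ : AnyVar L) ≠ ⟨t, x⟩) : subst x z (all y φ) = all y (subst x z φ) := by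
  simp only [subst, if_neg h]

@[simp] theorem subst_imp (φ ψ : Form L s) :
    subst x z (imp φ ψ) = imp (subst x z φ) (subst x z ψ) := rfl

@[simp] theorem subst_and (φ ψ : Form L s) :
    subst x z (and φ ψ) = and (subst x z φ) (subst x z ψ) := rfl

theorem subst_of_not_isFree {φ : Form L s} (h : ¬ IsFree ⟨t, x⟩ φ) : subst x z φ = φ := by
  induction φ with
  | prop p => rfl
  | nom j => rfl
  | svar y => exact subst_svar_of_ne fun e => h e.symm
  | neg φ ih => exact congrArg neg (ih h)
  | or φ ψ ih₁ ih₂ => exact congrArg₂ or (ih₁ fun h' => h (.inl h')) (ih₂ fun h' => h (.inr h'))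
  | app σ φ ih => exact congrArg (app σ) (funext fun i => ih i fun h' => h ⟨i, h'⟩)
  | @all _ r y φ ih =>
    by_cases hy : (⟨r, y⟩ : AnyVar L) = ⟨t, x⟩
    · simp only [subst, if_pos hy]
    · rw [subst_all_of_ne hy, ih fun h' => h ⟨Ne.symm hy, h'⟩]

theorem substitutable_of_not_isFree {φ : Form L s} (h : ¬ IsFree ⟨t, x⟩ φ) :
    Substitutable x z φ := by
  induction φ with
  | prop p => trivial
  | nom j => trivial
  | svar y => trivial
  | neg φ ih => exact ih h
  | or φ ψ ih₁ ih₂ => exact ⟨ih₁ fun h' => h (.inl h'), ih₂ fun h' => h (.inr h')⟩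
  | app σ φ ih => exact fun i => ih i fun h' => h ⟨i, h'⟩
  | all y φ ih => exact .inl h

theorem substitutable_of_not_isBound {φ : Form L s}
    (h : ∀ y, z = .var y → ¬ IsBound ⟨t, y⟩ φ) : Substitutable x z φ := by
  induction φ with
  | prop p => trivial
  | nom j => trivial
  | svar y => trivial
  | neg φ ih => exact ih h
  | or φ ψ ih₁ ih₂ =>
    exact ⟨ih₁ fun y e h' => h y e (.inl h'), ih₂ fun y e h' => h y e (.inr h')⟩
  | app σ φ ih => exact fun i => ih i fun y e h' => h y e ⟨i, h'⟩
  | all y φ ih =>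
    exact .inr ⟨fun y' e h' => h y' e (.inl h'), ih fun y' e h' => h y' e (.inr h')⟩

theorem substitutable_self {φ : Form L s} : Substitutable x (.var x) φ := by
  induction φ with
  | prop p => trivial
  | nom j => trivial
  | svar y => trivial
  | neg φ ih => exact ih
  | or φ ψ ih₁ ih₂ => exact ⟨ih₁, ih₂⟩
  | app σ φ ih => exact ih
  | @all _ r y φ ih =>
    by_cases hf : IsFree ⟨t, x⟩ (all y φ)
    · refine .inr ⟨fun y' e => ?_, ih⟩
      cases e
      exact hf.1
    · exact .inl hf

theorem subst_self {φ : Form L s} : subst x (.var x) φ = φ := by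
  induction φ with
  | prop p => rfl
  | nom j => rfl
  | @svar r y =>
    by_cases h : (⟨r, y⟩ : AnyVar L) = ⟨t, x⟩
    · cases h
      exact subst_svar_self
    · exact subst_svar_of_ne h
  | neg φ ih => exact congrArg neg ih
  | or φ ψ ih₁ ih₂ => exact congrArg₂ or ih₁ ih₂
  | app σ φ ih => exact congrArg (app σ) (funext ih)
  | @all _ r y φ ih =>
    by_cases h : (⟨r, y⟩ : AnyVar L) = ⟨t, x⟩
    · simp only [subst, if_pos h]
    · rw [subst_all_of_ne h, ih]

/-- Substituting a new variable `y` for `x` and then a symbol for `y`. -/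
theorem subst_subst {y : L.SVAR t} {φ : Form L s} (h : ¬ Occurs ⟨t, y⟩ φ) :
    subst y z (subst x (.var y) φ) = subst x z φ := by
  induction φ with
  | prop p => rfl
  | nom j => rfl
  | @svar r w =>
    by_cases hw : (⟨r, w⟩ : AnyVar L) = ⟨t, x⟩
    · cases hw
      rw [subst_svar_self, subst_svar_self]
      exact subst_svar_self
    · rw [subst_svar_of_ne hw, subst_svar_of_ne hw, subst_svar_of_ne fun e => h e.symm]
  | neg φ ih => exact congrArg neg (ih h)
  | or φ ψ ih₁ ih₂ => exact congrArg₂ or (ih₁ fun h' => h (.inl h')) (ih₂ fun h' => h (.inr h'))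
  | app σ φ ih => exact congrArg (app σ) (funext fun i => ih i fun h' => h ⟨i, h'⟩)
  | @all _ r w φ ih =>
    have hwy : (⟨r, w⟩ : AnyVar L) ≠ ⟨t, y⟩ := fun e => h (.inl e.symm)
    by_cases hw : (⟨r, w⟩ : AnyVar L) = ⟨t, x⟩
    · cases hw
      rw [subst_all_self, subst_all_self]
      exact subst_of_not_isFree fun h' => h h'.occurs
    · rw [subst_all_of_ne hw, subst_all_of_ne hw, subst_all_of_ne hwy,
        ih fun h' => h (.inr h')]

theorem not_isFree_subst {φ : Form L s} (hz : ∀ y, z = .var y → y ≠ x) :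
    ¬ IsFree ⟨t, x⟩ (subst x z φ) := by
  induction φ with
  | prop p => exact id
  | nom j => exact id
  | @svar r w =>
    by_cases hw : (⟨r, w⟩ : AnyVar L) = ⟨t, x⟩
    · cases hw
      rw [subst_svar_self]
      cases z with
      | nom j => exact id
      | var y =>
        intro e
        cases e
        exact hz _ rfl rfl
    · rw [subst_svar_of_ne hw]
      exact fun e => hw e.symm
  | neg φ ih => exact ih
  | or φ ψ ih₁ ih₂ => exact fun h => h.elim ih₁ ih₂
  | app σ φ ih => exact fun ⟨i, h⟩ => ih i h
  | @all _ r w φ ih =>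
    by_cases hw : (⟨r, w⟩ : AnyVar L) = ⟨t, x⟩
    · cases hw
      rw [subst_all_self]
      exact fun h => h.1 rfl
    · rw [subst_all_of_ne hw]
      exact fun h => ih h.2

/-- After substituting a new variable `y` for `x`, the variable `x` is substitutable for `y`. -/
theorem substitutable_subst {y : L.SVAR t} {φ : Form L s} (h : ¬ Occurs ⟨t, y⟩ φ) :
    Substitutable y (.var x) (subst x (.var y) φ) := by
  induction φ with
  | prop p => trivial
  | nom j => trivial
  | @svar r w =>
    by_cases hw : (⟨r, w⟩ : AnyVar L) = ⟨t, x⟩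
    · cases hw
      rw [subst_svar_self]
      trivial
    · rw [subst_svar_of_ne hw]
      trivial
  | neg φ ih => exact ih h
  | or φ ψ ih₁ ih₂ => exact ⟨ih₁ fun h' => h (.inl h'), ih₂ fun h' => h (.inr h')⟩
  | app σ φ ih => exact fun i => ih i fun h' => h ⟨i, h'⟩
  | @all _ r w φ ih =>
    by_cases hw : (⟨r, w⟩ : AnyVar L) = ⟨t, x⟩
    · cases hw
      rw [subst_all_self]
      exact substitutable_of_not_isFree fun h' => h h'.occurs
    · rw [subst_all_of_ne hw]
      refine .inr ⟨fun y' e => ?_, ih fun h' => h (.inr h')⟩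
      cases e
      exact Ne.symm hw

/-- Instances of a quantified formula are not subformulas of it; this is why the truth lemma is an
induction on depth. -/
theorem depth_subst {φ : Form L s} : depth (subst x z φ) = depth φ := by
  induction φ with
  | prop p => rfl
  | nom j => rfl
  | @svar r w =>
    by_cases hw : (⟨r, w⟩ : AnyVar L) = ⟨t, x⟩
    · cases hw
      rw [subst_svar_self]
      cases z <;> rfl
    · rw [subst_svar_of_ne hw]
  | neg φ ih => simp only [subst, depth, ih]
  | or φ ψ ih₁ ih₂ => simp only [subst, depth, ih₁, ih₂]
  | app σ φ ih => simp only [subst, depth, ih]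
  | @all _ r w φ ih =>
    by_cases hw : (⟨r, w⟩ : AnyVar L) = ⟨t, x⟩
    · simp only [subst, if_pos hw]
    · simp only [subst_all_of_ne hw, depth, ih]

theorem isBound_subst {v : AnyVar L} {φ : Form L s} :
    IsBound v (subst x z φ) ↔ IsBound v φ := by
  induction φ with
  | prop p => rfl
  | nom j => rfl
  | @svar r w =>
    by_cases hw : (⟨r, w⟩ : AnyVar L) = ⟨t, x⟩
    · cases hw
      rw [subst_svar_self]
      cases z <;> rfl
    · rw [subst_svar_of_ne hw]
  | neg φ ih => exact ih
  | or φ ψ ih₁ ih₂ => exact or_congr ih₁ ih₂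
  | app σ φ ih => exact exists_congr ih
  | @all _ r w φ ih =>
    by_cases hw : (⟨r, w⟩ : AnyVar L) = ⟨t, x⟩
    · simp only [subst, if_pos hw]
    · rw [subst_all_of_ne hw]
      exact or_congr Iff.rfl ih

end Subst

end Form

/-! ### Propositional reasoning -/

/-- A valuation of the formulas of one sort that respects `¬` and `∨`. -/
structure IsVal {s : L.S} (v : Form L s → Prop) : Prop where
  neg : ∀ φ, v (neg φ) ↔ ¬ v φ
  or : ∀ φ ψ, v (or φ ψ) ↔ v φ ∨ v ψ

namespace IsVal

variable {s : L.S} {v : Form L s → Prop} (hv : IsVal v)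
include hv

theorem imp (φ ψ : Form L s) : v (imp φ ψ) ↔ (v φ → v ψ) := by
  rw [Form.imp, hv.or, hv.neg, imp_iff_not_or]

theorem and (φ ψ : Form L s) : v (and φ ψ) ↔ v φ ∧ v ψ := by
  rw [Form.and, hv.neg, hv.or, hv.neg, hv.neg]
  tauto

theorem iff (φ ψ : Form L s) : v (iff φ ψ) ↔ (v φ ↔ v ψ) := by
  rw [Form.iff, hv.and, hv.imp, hv.imp]
  exact iff_def.symm

theorem top : v (top s) := by
  rw [Form.top, hv.or, hv.neg]
  exact em _

theorem bot : ¬ v (bot s) := by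
  rw [Form.bot, hv.neg, not_not]
  exact hv.top

theorem ex {t : L.S} (x : L.SVAR t) (φ : Form L s) : v (ex x φ) ↔ ¬ v (all x (φ.neg)) :=
  hv.neg _

theorem box {l : List L.S} (σ : L.Op l s) (φ : ∀ i : Fin l.length, Form L (l.get i)) :
    v (box σ φ) ↔ ¬ v (app σ fun i => (φ i).neg) :=
  hv.neg _

theorem conj (l : List (Form L s)) : v (conj l) ↔ ∀ φ ∈ l, v φ := by
  induction l with
  | nil => simpa [Form.conj] using hv.top
  | cons φ l ih => simp [Form.conj, hv.and, ih]

end IsVal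

/-- A property of dependent tuples that is preserved when the entries of `f` are replaced one by one
passes to the tuple in which all of them are replaced. -/
theorem exists_of_update {ι : Type*} [Fintype ι] [DecidableEq ι] {β : ι → Type*}
    {P : (∀ i, β i) → Prop} {Q : ∀ i, β i → Prop} {f : ∀ i, β i}
    (step : ∀ g i, g i = f i → P g → ∃ c, Q i c ∧ P (Function.update g i c)) (hf : P f) :
    ∃ g, (∀ i, Q i (g i)) ∧ P g := by
  suffices key : ∀ I : Finset ι, ∃ g, (∀ i ∈ I, Q i (g i)) ∧ (∀ i ∉ I, g i = f i) ∧ P g by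
    obtain ⟨g, h, -, hg⟩ := key Finset.univ
    exact ⟨g, fun i => h i (Finset.mem_univ i), hg⟩
  intro I
  induction I using Finset.induction_on with
  | empty => exact ⟨f, by simp, fun _ _ => rfl, hf⟩
  | insert i I hi ih =>
    obtain ⟨g, h₁, h₂, hg⟩ := ih
    obtain ⟨c, hc, hP⟩ := step g i (h₂ i hi) hg
    refine ⟨_, fun k hk => ?_, fun k hk => ?_, hP⟩
    · by_cases e : k = i
      · subst e
        rwa [Function.update_self]
      · rw [Function.update_of_ne e]
        exact h₁ k ((Finset.mem_insert.1 hk).resolve_left e)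
    · rw [Finset.mem_insert, not_or] at hk
      rw [Function.update_of_ne hk.1]
      exact h₂ k hk.2

namespace Provable

variable {s t : L.S} {φ ψ χ ω : Form L s}

theorem of_val (h : ∀ v : Form L s → Prop, IsVal v → v φ) : Provable φ :=
  taut φ fun v hn ho => h v ⟨hn, ho⟩

theorem cons (h₁ : Provable φ) (h : ∀ v : Form L s → Prop, IsVal v → v φ → v ψ) : Provable ψ :=
  mp h₁ (of_val fun v hv => (hv.imp _ _).2 (h v hv))

theorem cons₂ (h₁ : Provable φ) (h₂ : Provable ψ)
    (h : ∀ v : Form L s → Prop, IsVal v → v φ → v ψ → v χ) : Provable χ :=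
  mp h₂ (cons h₁ fun v hv h' => (hv.imp _ _).2 (h v hv h'))

theorem cons₃ (h₁ : Provable φ) (h₂ : Provable ψ) (h₃ : Provable χ)
    (h : ∀ v : Form L s → Prop, IsVal v → v φ → v ψ → v χ → v ω) : Provable ω :=
  mp h₃ (cons₂ h₁ h₂ fun v hv h' h'' => (hv.imp _ _).2 (h v hv h' h''))

theorem imp_refl (φ : Form L s) : Provable (imp φ φ) :=
  of_val fun v hv => by simp [hv.imp]

theorem imp_trans (h₁ : Provable (imp φ ψ)) (h₂ : Provable (imp ψ χ)) : Provable (imp φ χ) :=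
  cons₂ h₁ h₂ fun v hv => by simp only [hv.imp]; tauto

theorem contrapose (h : Provable (imp φ ψ)) : Provable (imp (neg ψ) (neg φ)) :=
  cons h fun v hv => by simp only [hv.imp, hv.neg]; tauto

theorem iff_intro (h₁ : Provable (imp φ ψ)) (h₂ : Provable (imp ψ φ)) : Provable (iff φ ψ) :=
  cons₂ h₁ h₂ fun v hv => by simp only [hv.imp, hv.iff]; tauto

theorem iff_mp (h : Provable (iff φ ψ)) : Provable (imp φ ψ) :=
  cons h fun v hv => by simp only [hv.imp, hv.iff]; tauto

theorem iff_mpr (h : Provable (iff φ ψ)) : Provable (imp ψ φ) :=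
  cons h fun v hv => by simp only [hv.imp, hv.iff]; tauto

/-! ### Quantifiers -/

theorem all_elim (x : L.SVAR t) (φ : Form L s) : Provable (imp (all x φ) φ) := by
  simpa only [subst_self] using Q2 x (.var x) φ substitutable_self

theorem all_intro (x : L.SVAR t) (hx : ¬ IsFree ⟨t, x⟩ φ) (h : Provable (imp φ ψ)) :
    Provable (imp φ (all x ψ)) :=
  mp (gen x h) (Q1 x φ ψ hx)

theorem all_mono (x : L.SVAR t) (h : Provable (imp φ ψ)) :
    Provable (imp (all x φ) (all x ψ)) :=
  all_intro x (fun h' => h'.1 rfl) (imp_trans (all_elim x φ) h)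

theorem ex_mono (x : L.SVAR t) (h : Provable (imp φ ψ)) : Provable (imp (ex x φ) (ex x ψ)) :=
  (all_mono x h.contrapose).contrapose

/-- Conjunction with a formula not containing the variable commutes with `∃`. -/
theorem and_ex (x : L.SVAR t) (hx : ¬ IsFree ⟨t, x⟩ φ) :
    Provable (imp (and φ (ex x ψ)) (ex x (and φ ψ))) := by
  have h : Provable (imp (and φ (all x (neg (and φ ψ)))) (neg ψ)) :=
    cons (all_elim x (neg (and φ ψ))) fun v hv => by
      simp only [hv.imp, hv.neg, hv.and]; tauto
  have hx' : ¬ IsFree ⟨t, x⟩ (and φ (all x (neg (and φ ψ)))) := by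
    rintro (h' | h')
    exacts [hx h', h'.1 rfl]
  have h' := all_intro x hx' h
  exact cons h' fun v hv => by simp only [hv.imp, hv.and, hv.ex]; tauto

/-- Each direction is an instance of Q2 followed by generalisation; in the second, putting x back
for the fresh y restores φ. -/
theorem all_rename (x y : L.SVAR t) (hy : ¬ Occurs ⟨t, y⟩ φ) :
    Provable (iff (all x φ) (all y (subst x (.var y) φ))) := by
  refine iff_intro (all_intro y (fun h => hy h.2.occurs) (Q2 x _ φ ?_)) ?_
  · exact substitutable_of_not_isBound fun y' e h => by cases e; exact hy h.occurs
  · by_cases hxy : x = y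
    · subst hxy
      rw [Form.subst_self]
      exact imp_refl _
    · refine all_intro x (fun h => ?_) ?_
      · exact not_isFree_subst (fun y' e => by cases e; exact Ne.symm hxy) h.2
      · have := Q2 y (.var x) (Form.subst x (.var y) φ) (substitutable_subst hy)
        rwa [subst_subst hy, Form.subst_self] at this

/-! ### Operations -/

section App

variable {l : List L.S} (σ : L.Op l s) (φ : ∀ i : Fin l.length, Form L (l.get i))
  (i : Fin l.length)

theorem box_K {ψ χ : Form L (l.get i)} (h : Provable (imp ψ χ)) :
    Provable (imp (box σ (Function.update φ i ψ)) (box σ (Function.update φ i χ))) := by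
  refine mp ?_ (K σ φ i ψ χ)
  exact ug σ _ i (by rwa [Function.update_self])

theorem neg_update (ψ : Form L (l.get i)) :
    (fun k => neg (Function.update φ i ψ k)) =
      Function.update (fun k => neg (φ k)) i (neg ψ) := by
  funext k
  exact Function.apply_update (fun _ => neg) φ i ψ k

theorem dual_update (ψ : Form L (l.get i)) :
    Provable (iff (app σ (Function.update φ i ψ))
      (neg (box σ (Function.update (fun k => neg (φ k)) i (neg ψ))))) := by
  rw [← neg_update]
  exact dual σ _

theorem app_update_mono {ψ χ : Form L (l.get i)} (h : Provable (imp ψ χ)) :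
    Provable (imp (app σ (Function.update φ i ψ)) (app σ (Function.update φ i χ))) :=
  cons₃ (dual_update σ φ i ψ) (dual_update σ φ i χ)
    (box_K σ (fun k => neg (φ k)) i h.contrapose) fun v hv => by
    simp only [hv.imp, hv.iff, hv.neg]; tauto

/-- Dually, this is K applied twice to the tautology ¬ψ → (¬χ → ¬(ψ ∨ χ)). -/
theorem app_update_or (ψ χ : Form L (l.get i)) :
    Provable (imp (app σ (Function.update φ i (or ψ χ)))
      (or (app σ (Function.update φ i ψ)) (app σ (Function.update φ i χ)))) := by
  have h₁ : Provable (imp (neg ψ) (imp (neg χ) (neg (or ψ χ)))) :=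
    of_val fun v hv => by simp only [hv.imp, hv.neg, hv.or]; tauto
  have h₂ := imp_trans (box_K σ (fun k => neg (φ k)) i h₁)
    (K σ (fun k => neg (φ k)) i (neg χ) (neg (or ψ χ)))
  have h₃ := cons₂ (dual_update σ φ i ψ) (dual_update σ φ i χ) fun v hv h h' =>
    (hv.and _ _).2 ⟨h, h'⟩
  exact cons₃ h₂ h₃ (dual_update σ φ i (or ψ χ)) fun v hv => by
    simp only [hv.imp, hv.iff, hv.neg, hv.or, hv.and]; tauto

theorem app_update_bot :
    Provable (neg (app σ (Function.update φ i (bot _)))) := by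
  have h₁ : Provable (neg (bot (L := L) (l.get i))) :=
    of_val fun v hv => by simp only [hv.neg]; exact hv.bot
  have h₂ : Provable (box σ (Function.update (fun k => neg (φ k)) i (neg (bot _)))) :=
    ug σ _ i (by rwa [Function.update_self])
  exact cons₂ h₂ (dual_update σ φ i (bot _)) fun v hv => by
    simp only [hv.iff, hv.neg]; tauto

/-- The contrapositive of Barcan, with the dual operation unfolded. -/
theorem app_update_ex (x : L.SVAR t) (ψ : Form L (l.get i))
    (hx : ∀ k, k ≠ i → ¬ IsFree ⟨t, x⟩ (φ k)) :
    Provable (imp (app σ (Function.update φ i (ex x ψ)))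
      (ex x (app σ (Function.update φ i ψ)))) := by
  have h₁ := barcan σ x (Function.update (fun k => neg (φ k)) i (neg ψ)) i fun k hk => by
    rw [Function.update_of_ne hk]
    exact hx k hk
  rw [Function.update_self, Function.update_idem] at h₁
  have h₂ : Provable (imp (all x (neg (app σ (Function.update φ i ψ))))
      (all x (box σ (Function.update (fun k => neg (φ k)) i (neg ψ))))) :=
    all_mono x <| cons (dual_update σ φ i ψ) fun v hv => by
      simp only [hv.imp, hv.iff, hv.neg]; tauto
  have h₃ : Provable (imp (all x (neg ψ)) (neg (ex x ψ))) :=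
    of_val fun v hv => by simp only [hv.imp, hv.neg, hv.ex]; tauto
  exact cons₂ (imp_trans (imp_trans h₂ h₁) (box_K σ _ i h₃)) (dual_update σ φ i (ex x ψ))
    fun v hv => by simp only [hv.imp, hv.neg, hv.ex, hv.iff]; tauto

theorem app_mono {σ} {φ ψ : ∀ i : Fin l.length, Form L (l.get i)}
    (h : ∀ i, Provable (imp (φ i) (ψ i))) : Provable (imp (app (s := s) σ φ) (app σ ψ)) := by
  obtain ⟨g, hg, hP⟩ := exists_of_update (P := fun g => Provable (imp (app σ φ) (app σ g)))
    (Q := fun i c => c = ψ i) (fun g i hi hg => ⟨ψ i, rfl, hg.imp_trans (by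
      have := app_update_mono σ g i (h i)
      rwa [← hi, Function.update_eq_self] at this)⟩) (imp_refl (app σ φ))
  rwa [funext hg] at hP

end App

end Provable

/-! ### Renaming of the state variables along injections -/

/-- The action of a sorted map on state variables of arbitrary sort. -/
abbrev AnyVar.map (ρ : ∀ t : L.S, L.SVAR t → L.SVAR t) (v : AnyVar L) : AnyVar L :=
  ⟨v.1, ρ v.1 v.2⟩

theorem AnyVar.map_injective {ρ : ∀ t : L.S, L.SVAR t → L.SVAR t}
    (hρ : ∀ t, Function.Injective (ρ t)) : Function.Injective (AnyVar.map ρ) := by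
  rintro ⟨s, x⟩ ⟨t, y⟩ h
  obtain ⟨h₁, h⟩ := Sigma.mk.inj_iff.1 h
  change s = t at h₁
  subst h₁
  exact congrArg (Sigma.mk s) (hρ s (eq_of_heq h))

/-- The action of a sorted map of state variables on the state symbols. -/
def StateSymbol.rename (ρ : ∀ t : L.S, L.SVAR t → L.SVAR t) {t : L.S} :
    StateSymbol L t → StateSymbol L t
  | .nom j => .nom j
  | .var x => .var (ρ t x)

namespace Form

/-- The formula with all its state variables, free and bound, renamed. -/
def rename (ρ : ∀ t : L.S, L.SVAR t → L.SVAR t) : {s : L.S} → Form L s → Form L s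
  | _, prop p => prop p
  | _, nom j => nom j
  | s, svar y => svar (ρ s y)
  | _, neg φ => neg (rename ρ φ)
  | _, or φ ψ => or (rename ρ φ) (rename ρ ψ)
  | _, app σ φ => app σ fun i => rename ρ (φ i)
  | _, all (t := t) y φ => all (ρ t y) (rename ρ φ)

variable {ρ : ∀ t : L.S, L.SVAR t → L.SVAR t}

theorem rename_ofSymbol {t : L.S} (z : StateSymbol L t) :
    rename ρ (ofSymbol z) = ofSymbol (z.rename ρ) := by
  cases z <;> rfl

theorem rename_conj {s : L.S} (l : List (Form L s)) :
    rename ρ (conj l) = conj (l.map (rename ρ)) := by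
  induction l with
  | nil => rfl
  | cons φ l ih =>
    change Form.and _ (rename ρ (conj l)) = _
    rw [ih]
    rfl

theorem rename_update {l : List L.S} (φ : ∀ i : Fin l.length, Form L (l.get i))
    (i : Fin l.length) (ψ : Form L (l.get i)) :
    (fun k => rename ρ (Function.update φ i ψ k)) =
      Function.update (fun k => rename ρ (φ k)) i (rename ρ ψ) := by
  funext k
  exact Function.apply_update (fun _ => rename ρ) φ i ψ k

theorem rename_fill {s t : L.S} (η : NC L t s) (φ : Form L t) :
    rename ρ (η.fill φ) = η.fill (rename ρ φ) := by
  induction η with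
  | hole => rfl
  | top s => rfl
  | app σ η ih => exact congrArg (app σ) (funext ih)

theorem occurs_rename {v : AnyVar L} {s : L.S} {φ : Form L s} (h : Occurs v (rename ρ φ)) :
    ∃ w, v = AnyVar.map ρ w := by
  induction φ with
  | prop p => exact h.elim
  | nom j => exact h.elim
  | @svar s x => exact ⟨⟨s, x⟩, h⟩
  | neg φ ih => exact ih h
  | or φ ψ ih₁ ih₂ => exact h.elim ih₁ ih₂
  | app σ φ ih => exact h.elim ih
  | @all _ t x φ ih => exact h.elim (fun h => ⟨⟨t, x⟩, h⟩) ih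

theorem Occurs.rename {v : AnyVar L} {s : L.S} {φ : Form L s} (h : Occurs v φ) :
    Occurs (AnyVar.map ρ v) (φ.rename ρ) := by
  induction φ with
  | prop p => exact h
  | nom j => exact h
  | svar x => exact congrArg (AnyVar.map ρ) h
  | neg φ ih => exact ih h
  | or φ ψ ih₁ ih₂ => exact Or.imp ih₁ ih₂ h
  | app σ φ ih => exact h.imp fun i => ih i
  | all x φ ih => exact Or.imp (congrArg (AnyVar.map ρ)) ih h

theorem rename_rename_of_leftInverse {τ : ∀ t : L.S, L.SVAR t → L.SVAR t} {s : L.S}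
    {φ : Form L s} (h : ∀ t x, Occurs ⟨t, x⟩ φ → τ t (ρ t x) = x) :
    rename τ (rename ρ φ) = φ := by
  induction φ with
  | prop p => rfl
  | nom j => rfl
  | @svar s x => exact congrArg svar (h s x rfl)
  | neg φ ih => exact congrArg neg (ih h)
  | or φ ψ ih₁ ih₂ =>
    exact congrArg₂ or (ih₁ fun t x h' => h t x (.inl h')) (ih₂ fun t x h' => h t x (.inr h'))
  | app σ φ ih => exact congrArg (app σ) (funext fun i => ih i fun t x h' => h t x ⟨i, h'⟩)
  | @all _ t x φ ih =>
    exact congrArg₂ all (h t x (.inl rfl)) (ih fun t x h' => h t x (.inr h'))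

section Injective

variable (hρ : ∀ t, Function.Injective (ρ t))
include hρ

theorem mk_rename_eq {s t : L.S} {x : L.SVAR s} {y : L.SVAR t} :
    (⟨s, ρ s x⟩ : AnyVar L) = ⟨t, ρ t y⟩ ↔ (⟨s, x⟩ : AnyVar L) = ⟨t, y⟩ :=
  (AnyVar.map_injective hρ).eq_iff (a := ⟨s, x⟩) (b := ⟨t, y⟩)

theorem isFree_rename {s t : L.S} {x : L.SVAR t} {φ : Form L s} :
    IsFree ⟨t, ρ t x⟩ (rename ρ φ) ↔ IsFree ⟨t, x⟩ φ := by
  induction φ with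
  | prop p => rfl
  | nom j => rfl
  | svar y => exact mk_rename_eq hρ
  | neg φ ih => exact ih
  | or φ ψ ih₁ ih₂ => exact or_congr ih₁ ih₂
  | app σ φ ih => exact exists_congr ih
  | all y φ ih => exact and_congr (not_congr (mk_rename_eq hρ)) ih

theorem rename_subst {s t : L.S} {x : L.SVAR t} {z : StateSymbol L t} {φ : Form L s} :
    rename ρ (subst x z φ) = subst (ρ t x) (z.rename ρ) (rename ρ φ) := by
  induction φ with
  | prop p => rfl
  | nom j => rfl
  | @svar r w =>
    by_cases hw : (⟨r, w⟩ : AnyVar L) = ⟨t, x⟩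
    · cases hw
      rw [subst_svar_self, rename_ofSymbol, rename, subst_svar_self]
    · rw [subst_svar_of_ne hw, rename, subst_svar_of_ne (mt (mk_rename_eq hρ).1 hw)]
  | neg φ ih => exact congrArg neg ih
  | or φ ψ ih₁ ih₂ => exact congrArg₂ or ih₁ ih₂
  | app σ φ ih => exact congrArg (app σ) (funext ih)
  | @all _ r w φ ih =>
    by_cases hw : (⟨r, w⟩ : AnyVar L) = ⟨t, x⟩
    · cases hw
      rw [subst_all_self, rename, subst_all_self]
    · rw [subst_all_of_ne hw, rename, rename, subst_all_of_ne (mt (mk_rename_eq hρ).1 hw), ih]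

theorem Substitutable.rename {s t : L.S} {x : L.SVAR t} {z : StateSymbol L t} {φ : Form L s}
    (h : Substitutable x z φ) : Substitutable (ρ t x) (z.rename ρ) (φ.rename ρ) := by
  induction φ with
  | prop p => trivial
  | nom j => trivial
  | svar y => trivial
  | neg φ ih => exact ih h
  | or φ ψ ih₁ ih₂ => exact ⟨ih₁ h.1, ih₂ h.2⟩
  | app σ φ ih => exact fun i => ih i (h i)
  | all y φ ih =>
    refine Or.imp (mt (isFree_rename hρ (φ := all y φ)).1) (fun h' => ⟨fun y' e => ?_, ih h'.2⟩) h
    cases z with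
    | nom j => cases e
    | var w =>
      cases e
      exact mt (mk_rename_eq hρ).1 (h'.1 w rfl)

end Injective

end Form

/-- Injectivity neither creates nor destroys free occurrences and causes no capture, so the side
conditions of the axioms survive. For tautologies, a valuation is composed with the renaming. -/
theorem Provable.rename {ρ : ∀ t : L.S, L.SVAR t → L.SVAR t}
    (hρ : ∀ t, Function.Injective (ρ t)) {s : L.S} {φ : Form L s} (h : Provable φ) :
    Provable (φ.rename ρ) := by
  induction h with
  | taut φ h =>
    exact taut _ fun v hn ho => h (fun ψ => v (ψ.rename ρ)) (fun ψ => hn _) fun ψ χ => ho _ _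
  | K σ φ i ψ χ =>
    have := K σ (fun k => (φ k).rename ρ) i (ψ.rename ρ) (χ.rename ρ)
    change Provable (imp (box σ fun k => (Function.update φ i (imp ψ χ) k).rename ρ)
      (imp (box σ fun k => (Function.update φ i ψ k).rename ρ)
        (box σ fun k => (Function.update φ i χ k).rename ρ)))
    simp only [rename_update]
    exact this
  | dual σ φ => exact dual σ fun k => (φ k).rename ρ
  | Q1 x φ ψ h => exact Q1 _ _ _ (mt (isFree_rename hρ).1 h)
  | Q2 x z φ h =>
    change Provable (imp _ (Form.rename ρ (subst x z φ)))
    rw [rename_subst hρ]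
    exact Q2 _ _ _ (Substitutable.rename hρ h)
  | name x => exact name _
  | @barcan l s t σ x φ i h =>
    have := barcan σ (ρ t x) (fun k => (φ k).rename ρ) i fun k hk =>
      mt (isFree_rename hρ).1 (h k hk)
    change Provable (imp _ (box σ fun k => (Function.update φ i (all x (φ i)) k).rename ρ))
    rw [rename_update]
    exact this
  | @nom s t η θ hη hθ x φ =>
    have := nom η θ hη hθ (ρ t x) (φ.rename ρ)
    change Provable (all _ (imp (Form.rename ρ (η.fill _)) (neg (Form.rename ρ (θ.fill _)))))
    rw [rename_fill, rename_fill]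
    exact this
  | mp _ _ ih₁ ih₂ => exact mp ih₁ ih₂
  | ug σ φ i _ ih => exact ug σ _ i ih
  | gen x _ ih => exact gen _ ih

/-- Renaming into infinitely many left out variables preserves consistency. -/
theorem exists_rename_consistent (hcount : L.IsCountable) (hvar : ∀ s : L.S, Infinite (L.SVAR s))
    {s : L.S} {Γ : Set (Form L s)} (hΓ : Consistent Γ) :
    ∃ ρ : ∀ t : L.S, L.SVAR t → L.SVAR t, (∀ t, Function.Injective (ρ t)) ∧
      (∀ t, (Set.range (ρ t))ᶜ.Infinite) ∧ Consistent (Form.rename ρ '' Γ) := by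
  have hcode : ∀ t, Nonempty (L.SVAR t ≃ ℕ) := fun t => by
    have := hcount.svars t
    have := hvar t
    exact nonempty_equiv_of_countable
  have e := fun t => (hcode t).some
  -- Variables move to even codes; those with odd codes stay unused.
  let ρ : ∀ t : L.S, L.SVAR t → L.SVAR t := fun t x => (e t).symm (2 * e t x)
  have hρ : ∀ t x, e t (ρ t x) = 2 * e t x := fun t x => (e t).apply_symm_apply _
  refine ⟨ρ, fun t x y h => ?_, fun t => ?_, ?_⟩
  · have := congrArg (e t) h
    rw [hρ, hρ] at this
    exact (e t).injective (by lia)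
  · refine Set.infinite_of_injective_forall_mem (f := fun n : ℕ => (e t).symm (2 * n + 1))
      (fun m n h => ?_) ?_
    · have := (e t).symm.injective h
      lia
    · rintro n ⟨x, hx⟩
      have := congrArg (e t) hx
      rw [hρ, Equiv.apply_symm_apply] at this
      lia
  · rintro ⟨l, hl, hp⟩
    have hfin : {v : AnyVar L | ∃ φ ∈ l, Occurs v φ}.Finite := by
      have := l.finite_toSet.biUnion fun φ _ => finite_occurs φ
      refine this.subset fun v ⟨φ, hφ, h⟩ => Set.mem_biUnion hφ h
    obtain ⟨N, hN⟩ := (hfin.image fun v : AnyVar L => e v.1 v.2).bddAbove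
    -- An inverse of doubling is needed only on codes up to `N`, which bounds all codes occurring in
    -- the finite list `l`. Every other code is sent above `N`, out of the way of the halves, so `f`
    -- is injective on all of ℕ and the derivation can be renamed back.
    let f : ℕ → ℕ := fun k => if k % 2 = 0 ∧ k ≤ N then k / 2 else N + 1 + k
    have hf : Function.Injective f := by
      intro a b h
      simp only [f] at h
      split_ifs at h <;> lia
    let τ : ∀ t : L.S, L.SVAR t → L.SVAR t := fun t x => (e t).symm (f (e t x))
    have hτ : ∀ t, Function.Injective (τ t) := fun t =>
      (e t).symm.injective.comp (hf.comp (e t).injective)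
    refine hΓ ⟨l.map (Form.rename τ), ?_, ?_⟩
    · intro ψ hψ
      obtain ⟨φ, hφ, rfl⟩ := List.mem_map.1 hψ
      obtain ⟨γ, hγ, rfl⟩ := hl φ hφ
      rwa [rename_rename_of_leftInverse]
      intro t x h
      have hb := hN ⟨_, ⟨_, hφ, h.rename (ρ := ρ)⟩, rfl⟩
      change e t (ρ t x) ≤ N at hb
      apply (e t).injective
      simp only [τ, Equiv.apply_symm_apply, hρ, f]
      rw [hρ] at hb
      rw [if_pos ⟨by lia, hb⟩]
      lia
    · have := hp.rename hτ
      rw [← rename_conj]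
      exact this

/-! ### Semantic lemmas -/

section Semantics

variable {M : Model L}

/-- The denotation of a state symbol. -/
noncomputable def StateSymbol.val (g : Assignment M) {t : L.S} : StateSymbol L t → M.W t
  | .nom j => Classical.choose (M.singleton j)
  | .var x => g ⟨t, x⟩

theorem sat_ofSymbol {g : Assignment M} {t : L.S} {w : M.W t} (z : StateSymbol L t) :
    Sat M g w (ofSymbol z) ↔ w = z.val g := by
  cases z with
  | nom j =>
    change w ∈ M.VNom j ↔ _
    rw [Classical.choose_spec (M.singleton j)]
    rfl
  | var x => rfl

theorem sat_congr {s : L.S} {φ : Form L s} {g h : Assignment M} {w : M.W s}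
    (hgh : ∀ v, IsFree v φ → g v = h v) : Sat M g w φ ↔ Sat M h w φ := by
  classical
  induction φ generalizing g h with
  | prop p => rfl
  | nom j => rfl
  | svar x =>
    change w = _ ↔ w = _
    rw [hgh _ rfl]
  | neg φ ih => exact not_congr (ih hgh)
  | or φ ψ ih₁ ih₂ =>
    exact or_congr (ih₁ fun v hv => hgh v (.inl hv)) (ih₂ fun v hv => hgh v (.inr hv))
  | app σ φ ih =>
    exact exists_congr fun u => and_congr Iff.rfl
      (forall_congr' fun i => ih i fun v hv => hgh v ⟨i, hv⟩)
  | @all s t x φ ih =>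
    have key : ∀ {g h : Assignment M}, (∀ v, IsFree v (all x φ) → g v = h v) →
        Sat M g w (all x φ) → Sat M h w (all x φ) := by
      intro g h hgh hs h' hh'
      refine (ih fun v hv => ?_).1 (hs (Function.update g ⟨t, x⟩ (h' ⟨t, x⟩))
        fun v hv => Function.update_of_ne hv _ _)
      by_cases e : v = ⟨t, x⟩
      · subst e
        rw [Function.update_self]
      · rw [Function.update_of_ne e, hh' v e, hgh v ⟨e, hv⟩]
    exact ⟨key hgh, key fun v hv => (hgh v hv).symm⟩

open Classical in
theorem sat_all_iff_update {g : Assignment M} {s t : L.S} {w : M.W s} {x : L.SVAR t}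
    {φ : Form L s} :
    Sat M g w (all x φ) ↔ ∀ a, Sat M (Function.update g ⟨t, x⟩ a) w φ := by
  constructor
  · exact fun h a => h _ fun v hv => Function.update_of_ne hv _ _
  · intro h g' hg'
    have e : g' = Function.update g ⟨t, x⟩ (g' ⟨t, x⟩) := by
      rw [Function.eq_update_iff]
      exact ⟨rfl, hg'⟩
    rw [e]
    exact h _

open Classical in
theorem sat_subst {s t : L.S} {x : L.SVAR t} {z : StateSymbol L t} {φ : Form L s}
    (hz : Substitutable x z φ) {g : Assignment M} {w : M.W s} :
    Sat M g w (subst x z φ) ↔ Sat M (Function.update g ⟨t, x⟩ (z.val g)) w φ := by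
  induction φ generalizing g with
  | prop p => rfl
  | nom j => rfl
  | @svar r y =>
    by_cases hy : (⟨r, y⟩ : AnyVar L) = ⟨t, x⟩
    · cases hy
      rw [subst_svar_self, sat_ofSymbol]
      change _ ↔ w = _
      rw [Function.update_self]
    · rw [subst_svar_of_ne hy]
      change w = _ ↔ w = _
      rw [Function.update_of_ne hy]
  | neg φ ih => exact not_congr (ih hz)
  | or φ ψ ih₁ ih₂ => exact or_congr (ih₁ hz.1) (ih₂ hz.2)
  | app σ φ ih =>
    exact exists_congr fun u => and_congr Iff.rfl (forall_congr' fun i => ih i (hz i))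
  | @all _ r y φ ih =>
    by_cases hf : IsFree ⟨t, x⟩ (all y φ)
    · obtain ⟨hzy, hz⟩ := hz.resolve_left (not_not.2 hf)
      rw [subst_all_of_ne (Ne.symm hf.1), sat_all_iff_update, sat_all_iff_update]
      refine forall_congr' fun a => ?_
      have e : z.val (Function.update g ⟨r, y⟩ a) = z.val g := by
        cases z with
        | nom j => rfl
        | var y' => exact Function.update_of_ne (hzy y' rfl) _ _
      rw [ih hz, e, Function.update_comm hf.1]
    · rw [subst_of_not_isFree hf]
      refine sat_congr fun v hv => (Function.update_of_ne ?_ _ _).symm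
      rintro rfl
      exact hf hv

theorem sat_all_rename {s t : L.S} {x y : L.SVAR t} {φ : Form L s} (hy : ¬ Occurs ⟨t, y⟩ φ)
    {g : Assignment M} {w : M.W s} :
    Sat M g w (all y (subst x (.var y) φ)) ↔ Sat M g w (all x φ) := by
  classical
  rw [sat_all_iff_update, sat_all_iff_update]
  refine forall_congr' fun a => ?_
  rw [sat_subst (substitutable_of_not_isBound
    fun y' e h => by cases e; exact hy h.occurs)]
  refine sat_congr fun v hv => ?_
  have hvy : v ≠ ⟨t, y⟩ := by
    rintro rfl
    exact hy hv.occurs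
  by_cases hvx : v = ⟨t, x⟩
  · subst hvx
    rw [Function.update_self, Function.update_self]
    exact Function.update_self _ _ _
  · rw [Function.update_of_ne hvx, Function.update_of_ne hvx, Function.update_of_ne hvy]

/-- Renaming of bound variables. -/
theorem exists_alpha (hvar : ∀ s : L.S, Infinite (L.SVAR s)) {s : L.S} (φ : Form L s)
    (v : AnyVar L) :
    ∃ φ' : Form L s, Provable (iff φ φ') ∧ depth φ' = depth φ ∧ ¬ IsBound v φ' ∧
      ∀ (M : Model L) (g : Assignment M) (w : M.W s), Sat M g w φ' ↔ Sat M g w φ := by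
  have hrefl : ∀ {s : L.S} (φ : Form L s), Provable (iff φ φ) := fun φ =>
    .iff_intro (.imp_refl φ) (.imp_refl φ)
  induction φ with
  | prop p => exact ⟨_, hrefl _, rfl, id, fun _ _ _ => Iff.rfl⟩
  | nom j => exact ⟨_, hrefl _, rfl, id, fun _ _ _ => Iff.rfl⟩
  | svar x => exact ⟨_, hrefl _, rfl, id, fun _ _ _ => Iff.rfl⟩
  | neg φ ih =>
    obtain ⟨φ', hp, hd, hb, hs⟩ := ih
    refine ⟨neg φ', hp.cons fun v hv => ?_, by simp only [depth, hd], hb,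
      fun M g w => not_congr (hs M g w)⟩
    simp only [hv.iff, hv.neg]
    tauto
  | or φ ψ ih₁ ih₂ =>
    obtain ⟨φ', hp, hd, hb, hs⟩ := ih₁
    obtain ⟨ψ', hp', hd', hb', hs'⟩ := ih₂
    refine ⟨or φ' ψ', hp.cons₂ hp' fun v hv => ?_, by simp only [depth, hd, hd'],
      fun h => Or.elim h hb hb', fun M g w => or_congr (hs M g w) (hs' M g w)⟩
    simp only [hv.iff, hv.or]
    tauto
  | app σ φ ih =>
    choose φ' hp hd hb hs using ih
    refine ⟨app σ φ', .iff_intro (.app_mono fun i => (hp i).iff_mp)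
      (.app_mono fun i => (hp i).iff_mpr), by simp only [depth, hd], fun ⟨i, h⟩ => hb i h,
      fun M g w => exists_congr fun u => and_congr Iff.rfl (forall_congr' fun i => hs i M g (u i))⟩
  | @all s t x φ ih =>
    obtain ⟨φ', hp, hd, hb, hs⟩ := ih
    have := hvar t
    -- The new bound variable must be fresh for the body and different from `v`.
    obtain ⟨y, -, hy⟩ := exists_not_occurs (t := t) Set.infinite_univ
      ((finite_occurs φ').union (Set.finite_singleton v))
    have hy₁ : ¬ Occurs ⟨t, y⟩ φ' := fun h => hy (.inl h)
    have hy₂ : v ≠ ⟨t, y⟩ := fun h => hy (.inr h.symm)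
    have hr := Provable.all_rename x y hy₁
    refine ⟨all y (subst x (.var y) φ'),
      .iff_intro ((Provable.all_mono x hp.iff_mp).imp_trans hr.iff_mp)
        (hr.iff_mpr.imp_trans (Provable.all_mono x hp.iff_mpr)),
      by simp only [depth, depth_subst, hd], ?_, fun M g w => ?_⟩
    · rintro (h | h)
      exacts [hy₂ h, hb (isBound_subst.1 h)]
    · rw [sat_all_rename hy₁]
      exact forall_congr' fun g' => imp_congr Iff.rfl (hs M g' w)

/-- At a quantifier, changing g at ρ(x) changes g ∘ ρ at x only, because ρ is injective. -/
theorem sat_rename {ρ : ∀ t : L.S, L.SVAR t → L.SVAR t} (hρ : ∀ t, Function.Injective (ρ t))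
    {s : L.S} {φ : Form L s} {g : Assignment M} {w : M.W s} :
    Sat M g w (φ.rename ρ) ↔ Sat M (fun v => g (v.map ρ)) w φ := by
  classical
  induction φ generalizing g with
  | prop p => rfl
  | nom j => rfl
  | svar x => rfl
  | neg φ ih => exact not_congr ih
  | or φ ψ ih₁ ih₂ => exact or_congr ih₁ ih₂
  | app σ φ ih =>
    exact exists_congr fun u => and_congr Iff.rfl (forall_congr' fun i => ih i)
  | @all _ t x φ ih =>
    refine sat_all_iff_update.trans (Iff.trans ?_
      (sat_all_iff_update (g := fun v => g (v.map ρ)) (x := x)).symm)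
    refine forall_congr' fun a => ih.trans (sat_congr fun v _ => ?_)
    by_cases hv : v = ⟨t, x⟩
    · subst hv
      rw [Function.update_self]
      exact (Function.update_self ⟨t, x⟩ a fun v => g (AnyVar.map ρ v)).symm
    · have hne : v.map ρ ≠ AnyVar.map ρ ⟨t, x⟩ := fun h => hv (AnyVar.map_injective hρ h)
      rw [Function.update_of_ne hv]
      exact Function.update_of_ne hne a g

theorem Satisfiable.of_rename {ρ : ∀ t : L.S, L.SVAR t → L.SVAR t}
    (hρ : ∀ t, Function.Injective (ρ t)) {s : L.S} {Γ : Set (Form L s)}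
    (h : Satisfiable (Form.rename ρ '' Γ)) : Satisfiable Γ := by
  obtain ⟨M, g, w, hs⟩ := h
  exact ⟨M, _, w, fun φ hφ => (sat_rename hρ).1 (hs _ ⟨φ, hφ, rfl⟩)⟩

end Semantics

/-! ### Linear contexts -/

/-- The contexts of sort `s` with a single occurrence of a placeholder of sort `t` in which all side
arguments are `⊤`, built from the root to the placeholder. -/
inductive Path (s : L.S) : L.S → Type u
  | root : Path s s
  | snoc {l : List L.S} {t : L.S} (η : Path s t) (σ : L.Op l t) (i : Fin l.length) :
      Path s (l.get i)

namespace Path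

/-- The application of `σ` to `φ` at the argument `i` and to `⊤` elsewhere. -/
noncomputable def appTop {l : List L.S} {t : L.S} (σ : L.Op l t) (i : Fin l.length)
    (φ : Form L (l.get i)) : Form L t :=
  app σ (Function.update (fun k => Form.top (l.get k)) i φ)

/-- The formula in which the placeholder is replaced by the given formula. -/
noncomputable def fill {s : L.S} : {t : L.S} → Path s t → Form L t → Form L s
  | _, root, φ => φ
  | _, snoc η σ i, φ => fill η (appTop σ i φ)

/-- The element of `NC` obtained by filling the placeholder with an element of `NC`. -/
def wrap {s r : L.S} : {t : L.S} → Path s t → NC L r t → NC L r s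
  | _, root, c => c
  | _, snoc η σ i, c => wrap η (NC.app σ (Function.update (fun _ => NC.top _) i c))

theorem hasHole_wrap {s r t : L.S} (η : Path s t) (c : NC L r t) (hc : c.HasHole) :
    (η.wrap c).HasHole := by
  induction η with
  | root => exact hc
  | snoc η σ i ih => exact ih _ ⟨i, by rwa [Function.update_self]⟩

/-- With c the bare placeholder, this turns a linear context into an element of NomC, to which the
axiom Nom applies. -/
theorem fill_wrap {s r t : L.S} (η : Path s t) (c : NC L r t) (φ : Form L r) :
    (η.wrap c).fill φ = η.fill (c.fill φ) := by
  induction η with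
  | root => rfl
  | snoc η σ i ih =>
    refine (ih _).trans (congrArg η.fill (congrArg (app σ) (funext fun k => ?_)))
    exact Function.apply_update (fun _ => NC.fill φ) _ i c k

section

variable {s t : L.S} (η : Path s t) {φ ψ : Form L t}

theorem not_isFree_top (v : AnyVar L) (t : L.S) : ¬ IsFree v (top t) := fun h => h.elim id id

theorem fill_mono (h : Provable (imp φ ψ)) : Provable (imp (η.fill φ) (η.fill ψ)) := by
  induction η with
  | root => exact h
  | snoc η σ i ih => exact ih (.app_update_mono σ _ i h)

theorem fill_or : Provable (imp (η.fill (or φ ψ)) (or (η.fill φ) (η.fill ψ))) := by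
  induction η with
  | root => exact .imp_refl _
  | snoc η σ i ih => exact (η.fill_mono (.app_update_or σ _ i φ ψ)).imp_trans ih

theorem fill_bot : Provable (neg (η.fill (bot t))) := by
  induction η with
  | root => exact .of_val fun v hv => (hv.neg _).2 hv.bot
  | @snoc l t η σ i ih =>
    have h : Provable (imp (appTop σ i (bot _)) (bot t)) :=
      (Provable.app_update_bot σ _ i).cons fun v hv h => (hv.imp _ _).2 fun h' =>
        ((hv.neg _).1 h h').elim
    exact (η.fill_mono h).cons₂ ih fun v hv => by simp only [hv.imp, hv.neg, fill]; tauto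

/-- Barcan at every node of the path. Its side condition is automatic, since the side arguments ⊤
contain no state variable. -/
theorem fill_ex {r : L.S} (x : L.SVAR r) :
    Provable (imp (η.fill (ex x φ)) (ex x (η.fill φ))) := by
  induction η with
  | root => exact .imp_refl _
  | snoc η σ i ih =>
    exact (η.fill_mono (.app_update_ex σ _ i x φ fun k _ => not_isFree_top _ _)).imp_trans ih

theorem subst_fill {r : L.S} (x : L.SVAR r) (z : StateSymbol L r) :
    subst x z (η.fill φ) = η.fill (subst x z φ) := by
  induction η with
  | root => rfl
  | snoc η σ i ih =>
    refine ih.trans (congrArg η.fill (congrArg (app σ) (funext fun k => ?_)))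
    exact Function.apply_update (fun _ => subst x z) _ i φ k

theorem substitutable_fill {r : L.S} {x : L.SVAR r} {z : StateSymbol L r}
    (h : Substitutable x z φ) : Substitutable x z (η.fill φ) := by
  induction η with
  | root => exact h
  | snoc η σ i ih =>
    refine ih fun k => ?_
    by_cases e : k = i
    · subst e
      rwa [Function.update_self]
    · rw [Function.update_of_ne e]
      exact ⟨trivial, trivial⟩

theorem isBound_fill {v : AnyVar L} (h : IsBound v φ) : IsBound v (η.fill φ) := by
  induction η with
  | root => exact h
  | snoc η σ i ih => exact ih ⟨i, by rwa [Function.update_self]⟩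

/-- The axiom `Nom` for linear contexts and arbitrary state symbols. -/
theorem provable_nom (hvar : ∀ s : L.S, Infinite (L.SVAR s)) (θ : Path s t)
    (z : StateSymbol L t) (φ : Form L t) :
    Provable (imp (η.fill (and (ofSymbol z) φ))
      (neg (θ.fill (neg (imp (ofSymbol z) φ))))) := by
  have := hvar t
  -- As x is fresh for φ, instantiating it by z affects only the displayed occurrences of x.
  obtain ⟨x, -, hx⟩ := exists_not_occurs (t := t) Set.infinite_univ (finite_occurs φ)
  replace hx : ¬ IsFree ⟨t, x⟩ φ := fun h => hx h.occurs
  have h := Provable.nom (η.wrap NC.hole) (θ.wrap NC.hole) (η.hasHole_wrap _ trivial)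
    (θ.hasHole_wrap _ trivial) x φ
  have hs : Substitutable x z φ := substitutable_of_not_isFree hx
  rw [NC.fillBox, fill_wrap, fill_wrap] at h
  have h' := h.mp (.Q2 x z _ ⟨η.substitutable_fill ⟨trivial, hs⟩,
    θ.substitutable_fill (φ := neg (imp (svar x) φ)) ⟨trivial, hs⟩⟩)
  change Provable (imp (subst x z (η.fill (and (svar x) φ)))
    (neg (subst x z (θ.fill (neg (imp (svar x) φ)))))) at h'
  have e₁ : subst x z (and (svar x) φ) = and (ofSymbol z) φ := by
    rw [subst_and, subst_svar_self, subst_of_not_isFree hx]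
  have e₂ : subst x z (neg (imp (svar x) φ)) = neg (imp (ofSymbol z) φ) := by
    rw [subst, subst_imp, subst_svar_self, subst_of_not_isFree hx]
  rwa [subst_fill, subst_fill, e₁, e₂] at h'

end

end Path

/-! ### Maximal consistent sets with witnesses -/

/-- The maximal consistent sets of formulas. -/
structure Ultra {s : L.S} (A : Set (Form L s)) : Prop extends IsVal (· ∈ A) where
  mem_of_provable : ∀ {φ}, Provable φ → φ ∈ A

theorem Ultra.mem {s : L.S} {A : Set (Form L s)} (hA : Ultra A) {φ ψ : Form L s}
    (h : Provable (imp φ ψ)) (hφ : φ ∈ A) : ψ ∈ A :=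
  (hA.toIsVal.imp φ ψ).1 (hA.mem_of_provable h) hφ

section Lindenbaum

variable {s : L.S} {A : Set (Form L s)} {φ ψ χ : Form L s}

theorem Derives.of_mem (h : φ ∈ A) : Derives A φ :=
  ⟨[φ], by simpa using h, .of_val fun v hv => by simp [hv.imp, hv.conj]⟩

theorem Derives.of_provable (h : Provable φ) : Derives A φ :=
  ⟨[], by simp, h.cons fun v hv h => (hv.imp _ _).2 fun _ => h⟩

theorem Derives.cons₂ (h₁ : Derives A φ) (h₂ : Derives A ψ)
    (h : ∀ v : Form L s → Prop, IsVal v → v φ → v ψ → v χ) : Derives A χ := by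
  obtain ⟨l₁, hl₁, hp₁⟩ := h₁
  obtain ⟨l₂, hl₂, hp₂⟩ := h₂
  refine ⟨l₁ ++ l₂, fun γ hγ => (List.mem_append.1 hγ).elim (hl₁ γ) (hl₂ γ),
    hp₁.cons₂ hp₂ fun v hv => ?_⟩
  simp only [hv.imp, hv.conj, List.mem_append]
  exact fun h₁ h₂ h₃ => h v hv (h₁ fun γ hγ => h₃ γ (.inl hγ)) (h₂ fun γ hγ => h₃ γ (.inr hγ))

theorem Derives.imp_of_insert (h : Derives (insert φ A) ψ) : Derives A (imp φ ψ) := by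
  classical
  obtain ⟨l, hl, hp⟩ := h
  refine ⟨l.filter (· ≠ φ), fun γ hγ => ?_, hp.cons fun v hv => ?_⟩
  · rw [List.mem_filter, decide_eq_true_iff] at hγ
    exact (hl γ hγ.1).resolve_left hγ.2
  · simp only [hv.imp, hv.conj, List.mem_filter, decide_eq_true_iff]
    intro h h₁ h₂
    refine h fun γ hγ => ?_
    by_cases e : γ = φ
    · exact e ▸ h₂
    · exact h₁ γ ⟨hγ, e⟩

theorem Consistent.insert_or (hA : Consistent A) (φ : Form L s) :
    Consistent (insert φ A) ∨ Consistent (insert (neg φ) A) := by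
  by_contra! h
  refine hA ((not_not.1 h.1).imp_of_insert.cons₂ (not_not.1 h.2).imp_of_insert fun v hv => ?_)
  simp only [hv.imp, hv.neg]
  tauto

theorem Consistent.ultra (hA : Consistent A) (h : ∀ φ, φ ∈ A ∨ neg φ ∈ A) : Ultra A := by
  have closed : ∀ {φ}, Derives A φ → φ ∈ A := fun {φ} hφ => (h φ).resolve_right fun hn =>
    hA (hφ.cons₂ (.of_mem hn) fun v hv h₁ h₂ => ((hv.neg _).1 h₂ h₁).elim)
  have hneg : ∀ φ, neg φ ∈ A ↔ φ ∉ A := fun φ => by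
    refine ⟨fun h₁ h₂ => ?_, (h φ).resolve_left⟩
    exact hA ((Derives.of_mem h₂).cons₂ (.of_mem h₁) fun v hv h₁ h₂ => ((hv.neg _).1 h₂ h₁).elim)
  refine ⟨⟨hneg, fun φ ψ => ⟨fun h₁ => ?_, ?_⟩⟩, fun hφ => closed (.of_provable hφ)⟩
  · by_contra! h₂
    refine h₂.2 (closed ((Derives.of_mem h₁).cons₂ (.of_mem ((hneg φ).2 h₂.1)) fun v hv => ?_))
    simp only [hv.or, hv.neg]
    tauto
  · rintro (h₁ | h₁)
    · exact closed ((Derives.of_mem h₁).cons₂ (.of_mem h₁) fun v hv h _ => (hv.or _ _).2 (.inl h))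
    · exact closed ((Derives.of_mem h₁).cons₂ (.of_mem h₁) fun v hv h _ => (hv.or _ _).2 (.inr h))

theorem not_isFree_conj {v : AnyVar L} {l : List (Form L s)} (h : ∀ φ ∈ l, ¬ IsFree v φ) :
    ¬ IsFree v (conj l) := by
  induction l with
  | nil => exact Path.not_isFree_top v s
  | cons φ l ih =>
    rintro (h' | h')
    · exact h φ (by simp) h'
    · exact ih (fun ψ hψ => h ψ (by simp [hψ])) h'

/-- Otherwise A derives ¬φ[y/x]; since y is fresh for A, generalising and renaming gives ∀x ¬φ,
against the existential member. -/
theorem Consistent.insert_witness {t : L.S} {x y : L.SVAR t} (hA : Consistent A)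
    (hφ : ex x φ ∈ A) (hy : ∀ γ ∈ A, ¬ Occurs ⟨t, y⟩ γ) :
    Consistent (insert (subst x (.var y) φ) A) := by
  intro h
  obtain ⟨l, hl, hp⟩ := h.imp_of_insert
  have hy' : ¬ Occurs ⟨t, y⟩ (neg φ) := fun h => hy _ hφ (.inr h)
  have h₁ : Provable (imp (conj l) (subst x (.var y) (neg φ))) := by
    refine hp.cons fun v hv => ?_
    simp only [hv.imp, subst, hv.neg, hv.bot]
    exact id
  have h₂ := Provable.all_intro y (not_isFree_conj fun γ hγ h => hy γ (hl γ hγ) h.occurs) h₁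
  have h₃ : Derives A (all x (neg φ)) := ⟨l, hl, h₂.imp_trans (.iff_mpr (.all_rename x y hy'))⟩
  exact hA (h₃.cons₂ (.of_mem hφ) fun v hv h₁ h₂ => ((hv.ex _ _).1 h₂ h₁).elim)

/-- Infinitely many state variables of each sort do not occur in the set. -/
def Roomy (A : Set (Form L s)) : Prop :=
  ∀ t : L.S, {x : L.SVAR t | ∀ γ ∈ A, ¬ Occurs ⟨t, x⟩ γ}.Infinite

theorem Roomy.insert (hA : Roomy A) (φ : Form L s) : Roomy (insert φ A) := by
  intro t
  have hfin : ((Sigma.mk t : L.SVAR t → AnyVar L) ⁻¹' {v | Occurs v φ}).Finite :=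
    (finite_occurs φ).preimage sigma_mk_injective.injOn
  refine ((hA t).sdiff hfin).mono fun x hx γ hγ => ?_
  rcases hγ with rfl | hγ
  exacts [hx.2, hx.1 γ hγ]

/-- One stage of the Lindenbaum construction: φ is decided and, if an accepted existential,
witnessed at once. At most two formulas are added, so fresh variables remain. -/
theorem exists_step (hA : Consistent A) (hr : Roomy A) (φ : Form L s) :
    ∃ B, A ⊆ B ∧ Consistent B ∧ Roomy B ∧ (neg φ ∈ B ∨ (φ ∈ B ∧
      ∀ (t : L.S) (x : L.SVAR t) (ψ : Form L s), φ = ex x ψ →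
        ∃ y : L.SVAR t, ¬ Occurs ⟨t, y⟩ ψ ∧ subst x (.var y) ψ ∈ B)) := by
  rcases hA.insert_or φ with h | h
  · by_cases hex : ∃ (t : L.S) (x : L.SVAR t) (ψ : Form L s), φ = ex x ψ
    · obtain ⟨t, x, ψ, rfl⟩ := hex
      obtain ⟨y, hy⟩ := (hr.insert (ex x ψ) t).nonempty
      refine ⟨_, (Set.subset_insert _ _).trans (Set.subset_insert _ _),
        h.insert_witness (Set.mem_insert _ _) hy, (hr.insert _).insert _,
        .inr ⟨.inr (.inl rfl), fun t' x' ψ' e => ?_⟩⟩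
      cases e
      exact ⟨y, fun h' => hy _ (.inl rfl) (.inr h'), .inl rfl⟩
    · exact ⟨_, Set.subset_insert _ _, h, hr.insert _, .inr ⟨.inl rfl, fun t x ψ e =>
        (hex ⟨t, x, ψ, e⟩).elim⟩⟩
  · exact ⟨_, Set.subset_insert _ _, h, hr.insert _, .inl (.inl rfl)⟩

/-- The set contains a witness for each of its existential members. -/
def HasWitnesses (A : Set (Form L s)) : Prop :=
  ∀ {t : L.S} (x : L.SVAR t) (ψ : Form L s), ex x ψ ∈ A →
    ∃ y : L.SVAR t, ¬ Occurs ⟨t, y⟩ ψ ∧ subst x (.var y) ψ ∈ A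

theorem exists_ultra (hcount : L.IsCountable) (hA : Consistent A) (hr : Roomy A) :
    ∃ B, A ⊆ B ∧ Ultra B ∧ HasWitnesses B := by
  have := countable_form hcount s
  have : Nonempty (Form L s) := ⟨top s⟩
  obtain ⟨e, he⟩ := exists_surjective_nat (Form L s)
  choose next hsub hcon hroom hnext using fun (C : {C : Set (Form L s) // Consistent C ∧ Roomy C})
    (n : ℕ) => exists_step C.2.1 C.2.2 (e n)
  let seq : ℕ → {C : Set (Form L s) // Consistent C ∧ Roomy C} := fun n =>
    Nat.rec ⟨A, hA, hr⟩ (fun n C => ⟨next C n, hcon C n, hroom C n⟩) n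
  have hmono : Monotone fun n => (seq n).1 := monotone_nat_of_le_succ fun n => hsub (seq n) n
  have hseq : ∀ n, (seq (n + 1)).1 ⊆ ⋃ n, (seq n).1 := fun n =>
    Set.subset_iUnion (fun n => (seq n).1) (n + 1)
  have hB : Consistent (⋃ n, (seq n).1) := by
    rintro ⟨l, hl, hp⟩
    obtain ⟨N, hN⟩ : ∃ N, ∀ γ ∈ l, γ ∈ (seq N).1 := by
      clear hp
      induction l with
      | nil => exact ⟨0, by simp⟩
      | cons γ l ih =>
        obtain ⟨N, hN⟩ := ih fun γ hγ => hl γ (by simp [hγ])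
        obtain ⟨m, hm⟩ := Set.mem_iUnion.1 (hl γ (by simp))
        refine ⟨max m N, fun δ hδ => ?_⟩
        rcases List.mem_cons.1 hδ with rfl | hδ
        · exact hmono (le_max_left m N) hm
        · exact hmono (le_max_right m N) (hN δ hδ)
    exact (seq N).2.1 ⟨l, hN, hp⟩
  have hU : Ultra (⋃ n, (seq n).1) := hB.ultra fun φ => by
    obtain ⟨n, rfl⟩ := he φ
    rcases hnext (seq n) n with h | h
    · exact .inr (hseq n h)
    · exact .inl (hseq n h.1)
  refine ⟨_, Set.subset_iUnion (fun n => (seq n).1) 0, hU, fun {t} x ψ hψ => ?_⟩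
  obtain ⟨n, hn⟩ := he (ex x ψ)
  rcases hnext (seq n) n with h | h
  · rw [hn] at h
    exact ((hU.neg _).1 (hseq n h) hψ).elim
  · obtain ⟨y, hy, hm⟩ := h.2 t x ψ hn
    exact ⟨y, hy, hseq n hm⟩

end Lindenbaum

/-! ### The canonical model -/

section Canonical

variable {s : L.S} {A : Set (Form L s)}

/-- The formulas that hold, according to `A`, at the world named by `z`. The set is empty if no
context reaches that world. -/
def World (A : Set (Form L s)) {t : L.S} (z : StateSymbol L t) : Set (Form L t) :=
  {φ | ∃ η : Path s t, η.fill (and (ofSymbol z) φ) ∈ A}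

/-- A context reaching z extends by σ to its i-th argument, after the other arguments are weakened
to ⊤. -/
theorem mem_world_of_step {t : L.S} {z : StateSymbol L t} {l : List L.S} {σ : L.Op l t}
    {φ : ∀ i : Fin l.length, Form L (l.get i)} {i : Fin l.length} {y : StateSymbol L (l.get i)}
    {χ : Form L (l.get i)} (hA : Ultra A) (h : app σ φ ∈ World A z)
    (hi : Provable (imp (φ i) (and (ofSymbol y) χ))) : χ ∈ World A y := by
  obtain ⟨η, hη⟩ := h
  refine ⟨η.snoc σ i, hA.mem (η.fill_mono ?_) hη⟩
  have h₁ : Provable (imp (app σ φ) (Path.appTop σ i (and (ofSymbol y) χ))) := by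
    refine .app_mono fun k => ?_
    by_cases e : k = i
    · subst e
      rwa [Function.update_self]
    · rw [Function.update_of_ne e]
      exact .of_val fun v hv => (hv.imp _ _).2 fun _ => hv.top
  exact h₁.cons fun v hv => by simp only [hv.imp, hv.and]; tauto

theorem mem_world_root (hA : Ultra A) {z : StateSymbol L s} (hz : ofSymbol z ∈ A) {φ : Form L s}
    (hφ : φ ∈ A) : φ ∈ World A z :=
  ⟨.root, (hA.and _ _).2 ⟨hz, hφ⟩⟩

theorem world_mono (hA : Ultra A) {t : L.S} {z : StateSymbol L t} {φ ψ : Form L t}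
    (h : Provable (imp φ ψ)) (hφ : φ ∈ World A z) : ψ ∈ World A z := by
  obtain ⟨η, hη⟩ := hφ
  refine ⟨η, hA.mem (η.fill_mono (h.cons fun v hv => ?_)) hη⟩
  simp only [hv.imp, hv.and]
  tauto

/-- Distributing one context over φ ∨ ¬φ decides every formula. Closure under conjunction is where
Nom enters, as the two conjuncts may come from different contexts. -/
theorem ultra_world (hvar : ∀ s : L.S, Infinite (L.SVAR s)) (hA : Ultra A) {t : L.S}
    {z : StateSymbol L t} (hz : (World A z).Nonempty) : Ultra (World A z) := by
  obtain ⟨χ, η, hη⟩ := hz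
  have hbot : bot t ∉ World A z := by
    rintro ⟨θ, hθ⟩
    refine (hA.neg _).1 (hA.mem_of_provable θ.fill_bot) (hA.mem (θ.fill_mono ?_) hθ)
    exact .of_val fun v hv => by simp only [hv.imp, hv.and]; tauto
  have hem : ∀ φ, φ ∈ World A z ∨ neg φ ∈ World A z := fun φ => by
    have h : Provable (imp (and (ofSymbol z) χ)
        (or (and (ofSymbol z) φ) (and (ofSymbol z) (neg φ)))) :=
      .of_val fun v hv => by simp only [hv.imp, hv.and, hv.or, hv.neg]; tauto
    exact ((hA.or _ _).1 (hA.mem ((η.fill_mono h).imp_trans η.fill_or) hη)).imp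
      (fun h => ⟨η, h⟩) fun h => ⟨η, h⟩
  have hand : ∀ {φ ψ}, φ ∈ World A z → ψ ∈ World A z → and φ ψ ∈ World A z := by
    rintro φ ψ ⟨η, hη⟩ ⟨θ, hθ⟩
    -- Nom carries φ from η to θ: A cannot contain θ(¬(z → φ)), the other half of the split of θ(z ∧
    -- ψ) below.
    have h₁ := (hA.neg _).1 (hA.mem (η.provable_nom hvar θ z φ) hη)
    have h₂ : Provable (imp (and (ofSymbol z) ψ)
        (or (and (ofSymbol z) (and φ ψ)) (neg (imp (ofSymbol z) φ)))) :=
      .of_val fun v hv => by simp only [hv.imp, hv.and, hv.or, hv.neg]; tauto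
    exact ⟨θ, ((hA.or _ _).1
      (hA.mem ((θ.fill_mono h₂).imp_trans θ.fill_or) hθ)).resolve_right h₁⟩
  have habs : ∀ {φ}, φ ∈ World A z → neg φ ∈ World A z → False := fun h₁ h₂ =>
    hbot (world_mono hA (.of_val fun v hv => by simp only [hv.imp, hv.and, hv.neg]; tauto)
      (hand h₁ h₂))
  have hneg : ∀ φ, neg φ ∈ World A z ↔ φ ∉ World A z := fun φ =>
    ⟨fun h₂ h₁ => habs h₁ h₂, (hem φ).resolve_left⟩
  refine ⟨⟨hneg, fun φ ψ => ⟨fun h => ?_, ?_⟩⟩, fun {φ} h => ?_⟩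
  · by_contra! h'
    refine habs h (world_mono hA (.of_val fun v hv => ?_)
      (hand ((hneg φ).2 h'.1) ((hneg ψ).2 h'.2)))
    simp only [hv.imp, hv.and, hv.neg, hv.or]
    tauto
  · rintro (h | h)
    · exact world_mono hA (.of_val fun v hv => by simp only [hv.imp, hv.or]; tauto) h
    · exact world_mono hA (.of_val fun v hv => by simp only [hv.imp, hv.or]; tauto) h
  · exact world_mono hA (h.cons fun v hv h => (hv.imp _ _).2 fun _ => h) ⟨η, hη⟩

theorem ofSymbol_mem_world (hA : Ultra A) {t : L.S} {z : StateSymbol L t}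
    (hz : (World A z).Nonempty) : ofSymbol z ∈ World A z := by
  obtain ⟨χ, η, hη⟩ := hz
  exact ⟨η, hA.mem (η.fill_mono (.of_val fun v hv => by
    simp only [hv.imp, hv.and]; tauto)) hη⟩

/-- A context placing z' ∧ φ at z also reaches z' with φ. The reverse inclusion follows because z
itself then belongs to the world of z'. -/
theorem world_eq_of_mem (hvar : ∀ s : L.S, Infinite (L.SVAR s)) (hA : Ultra A) {t : L.S}
    {z z' : StateSymbol L t} (h : ofSymbol z' ∈ World A z) : World A z = World A z' := by
  have key : ∀ {z z' : StateSymbol L t}, ofSymbol z' ∈ World A z → World A z ⊆ World A z' := by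
    intro z z' h φ hφ
    have hU := ultra_world hvar hA ⟨_, h⟩
    obtain ⟨η, hη⟩ := (hU.and _ _).2 ⟨h, hφ⟩
    exact ⟨η, hA.mem (η.fill_mono (.of_val fun v hv => by
      simp only [hv.imp, hv.and]; tauto)) hη⟩
  exact (key h).antisymm (key (key h (ofSymbol_mem_world hA ⟨_, h⟩)))

theorem world_eq_iff (hvar : ∀ s : L.S, Infinite (L.SVAR s)) (hA : Ultra A) {t : L.S}
    {z z' : StateSymbol L t} (hz : (World A z).Nonempty) :
    World A z = World A z' ↔ ofSymbol z' ∈ World A z :=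
  ⟨fun h => h ▸ ofSymbol_mem_world hA (h ▸ hz), world_eq_of_mem hvar hA⟩

/-- The quantifier is moved to the root of the context, where A supplies a witness. That witness is
new to the whole filled formula, hence not bound in ψ, which later makes it substitutable. -/
theorem world_witness (hvar : ∀ s : L.S, Infinite (L.SVAR s)) (hA : Ultra A)
    (hw : HasWitnesses A) {t r : L.S} {z : StateSymbol L t} {x : L.SVAR r} {ψ : Form L t}
    (h : ex x ψ ∈ World A z) :
    ∃ y : L.SVAR r, ¬ IsBound ⟨r, y⟩ ψ ∧ subst x (.var y) ψ ∈ World A z := by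
  obtain ⟨η, hη⟩ := h
  have := hvar r
  -- The symbol z may be the variable x itself, so the bound variable is renamed before the
  -- quantifier is pulled across z.
  obtain ⟨y, -, hy⟩ := exists_not_occurs (t := r) Set.infinite_univ
    ((finite_occurs ψ).union (finite_occurs (ofSymbol z)))
  have hyψ : ¬ Occurs ⟨r, y⟩ ψ := fun h => hy (.inl h)
  have hyz : ¬ IsFree ⟨r, y⟩ (ofSymbol z) := fun h => hy (.inr h.occurs)
  have h₁ : Provable (imp (ex x ψ) (ex y (subst x (.var y) ψ))) :=
    Provable.contrapose (.iff_mpr (.all_rename x y (φ := neg ψ) hyψ))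
  have h₂ : Provable (imp (and (ofSymbol z) (ex x ψ))
      (ex y (and (ofSymbol z) (subst x (.var y) ψ)))) :=
    h₁.cons₂ (.and_ex y hyz) fun v hv => by simp only [hv.imp, hv.and]; tauto
  obtain ⟨u, hu, hm⟩ := hw y _ (hA.mem ((η.fill_mono h₂).imp_trans (η.fill_ex y)) hη)
  refine ⟨u, fun h => hu (IsBound.occurs (η.isBound_fill (.inr ?_))), η, ?_⟩
  · exact isBound_subst.2 h
  · rwa [Path.subst_fill, subst_and, subst_of_not_isFree hyz, subst_subst hyψ] at hm

/-- Name rewrites an argument φᵢ as ∃x (x ∧ φᵢ); Barcan extracts the quantifier and a witness names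
the successor. The arguments are treated one at a time, all within the same world. -/
theorem world_successor (hvar : ∀ s : L.S, Infinite (L.SVAR s)) (hA : Ultra A)
    (hw : HasWitnesses A) {t : L.S} {z : StateSymbol L t} {l : List L.S} {σ : L.Op l t}
    {φ : ∀ i : Fin l.length, Form L (l.get i)} (h : app σ φ ∈ World A z) :
    ∃ y : ∀ i : Fin l.length, L.SVAR (l.get i),
      (app σ fun i => and (svar (y i)) (φ i)) ∈ World A z := by
  suffices hg : ∃ g, (∀ i, ∃ y, g i = and (svar y) (φ i)) ∧ app σ g ∈ World A z by
    obtain ⟨g, hg, hm⟩ := hg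
    choose y hy using hg
    exact ⟨y, by rwa [← funext hy]⟩
  refine exists_of_update (P := fun g => app σ g ∈ World A z)
    (Q := fun i c => ∃ y, c = and (svar y) (φ i)) (fun g i hi hm => ?_) h
  have := hvar (l.get i)
  obtain ⟨x, -, hx⟩ := exists_not_occurs (t := l.get i) Set.infinite_univ
    (Set.finite_iUnion fun k => finite_occurs (g k))
  have hx' : ∀ k, ¬ IsFree ⟨_, x⟩ (g k) := fun k h => hx (Set.mem_iUnion.2 ⟨k, h.occurs⟩)
  have h₁ : Provable (imp (φ i) (ex x (and (φ i) (svar x)))) :=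
    (Provable.name x).cons₂ (.and_ex x (hi ▸ hx' i)) fun v hv => by
      simp only [hv.imp, hv.and]; tauto
  have h₂ : Provable (imp (φ i) (ex x (and (svar x) (φ i)))) :=
    h₁.imp_trans (.ex_mono x (.of_val fun v hv => by simp only [hv.imp, hv.and]; tauto))
  have h₃ := (Provable.app_update_mono σ g i h₂).imp_trans
    (.app_update_ex σ g i x _ fun k _ => hx' k)
  rw [← hi, Function.update_eq_self] at h₃
  obtain ⟨y, -, hy⟩ := world_witness hvar hA hw (world_mono hA h₃ hm)
  refine ⟨_, ⟨y, rfl⟩, ?_⟩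
  convert hy using 1
  refine congrArg (app σ) (funext fun k => ?_)
  refine Eq.trans ?_
    (Function.apply_update (fun _ => subst x (.var y)) g i (and (svar x) (g i)) k).symm
  rw [subst_and, subst_svar_self, subst_of_not_isFree (hx' i), hi]
  exact congrArg (fun f => Function.update f i _ k)
    (funext fun k => (subst_of_not_isFree (hx' k)).symm)

/-- The model whose worlds are the sets `World A z`. -/
def canonicalModel (hvar : ∀ s : L.S, Infinite (L.SVAR s)) (A : Set (Form L s)) : Model L where
  -- Symbols that no context reaches all name the world ∅, so every symbol denotes; the truth lemma
  -- makes no claim at ∅.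
  W t := {B : Set (Form L t) // ∃ z : StateSymbol L t, World A z = B}
  nonempty t := ⟨⟨_, .var (hvar t).nonempty.some, rfl⟩⟩
  R {l _} σ w u := ∃ y : ∀ i : Fin l.length, StateSymbol L (l.get i),
    (∀ i, World A (y i) = (u i).1) ∧ (app σ fun i => ofSymbol (y i)) ∈ w.1
  V p := {w | prop p ∈ w.1}
  VNom j := {⟨World A (.nom j), _, rfl⟩}
  singleton _ := ⟨_, rfl⟩

/-- The world of the canonical model that is named by a state symbol. -/
def canonicalWorld (hvar : ∀ s : L.S, Infinite (L.SVAR s)) (A : Set (Form L s)) {t : L.S}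
    (z : StateSymbol L t) : (canonicalModel hvar A).W t :=
  ⟨World A z, z, rfl⟩

/-- The assignment under which each state variable names itself. -/
def canonicalAssignment (hvar : ∀ s : L.S, Infinite (L.SVAR s)) (A : Set (Form L s)) :
    Assignment (canonicalModel hvar A) :=
  fun v => canonicalWorld hvar A (.var v.2)

theorem val_canonical (hvar : ∀ s : L.S, Infinite (L.SVAR s)) {t : L.S} (z : StateSymbol L t) :
    z.val (canonicalAssignment hvar A) = canonicalWorld hvar A z := by
  refine ((sat_ofSymbol (g := canonicalAssignment hvar A) z).1 ?_).symm
  cases z <;> rfl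

/-- The assignment stays fixed: since every world has a name, updating a variable amounts to
substituting a symbol. -/
theorem sat_canonical_iff (hvar : ∀ s : L.S, Infinite (L.SVAR s)) (hA : Ultra A)
    (hw : HasWitnesses A) (n : ℕ) {t : L.S} {φ : Form L t} (hφ : depth φ < n)
    {z : StateSymbol L t} (hz : (World A z).Nonempty) :
    Sat _ (canonicalAssignment hvar A) (canonicalWorld hvar A z) φ ↔ φ ∈ World A z := by
  classical
  induction n generalizing t φ z with
  | zero => exact absurd hφ (Nat.not_lt_zero _)
  | succ n ih =>
    have hU := ultra_world hvar hA hz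
    cases φ with
    | prop p => rfl
    | nom j => exact Subtype.ext_iff.trans (world_eq_iff hvar hA (z' := .nom j) hz)
    | svar x => exact Subtype.ext_iff.trans (world_eq_iff hvar hA (z' := .var x) hz)
    | neg φ => exact (not_congr (ih (Nat.lt_of_succ_lt_succ hφ) hz)).trans (hU.neg φ).symm
    | or φ ψ =>
      have h := max_lt_iff.1 (Nat.lt_of_succ_lt_succ hφ)
      exact (or_congr (ih h.1 hz) (ih h.2 hz)).trans (hU.or φ ψ).symm
    | app σ φ =>
      have hd : ∀ i, depth (φ i) < n := fun i =>
        (depth_lt_app σ φ i).trans_le (Nat.le_of_lt_succ hφ)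
      constructor
      · rintro ⟨u, ⟨y, hy, hm⟩, hs⟩
        obtain rfl : u = fun i => canonicalWorld hvar A (y i) :=
          funext fun i => Subtype.ext (hy i).symm
        suffices hg : ∃ g, (∀ i, g i = and (ofSymbol (y i)) (φ i)) ∧ app σ g ∈ World A z by
          obtain ⟨g, hg, hP⟩ := hg
          refine world_mono hA (.app_mono fun i => ?_) hP
          rw [hg i]
          exact .of_val fun v hv => by simp only [hv.imp, hv.and]; tauto
        refine exists_of_update (P := fun g => app σ g ∈ World A z)
          (Q := fun i c => c = and (ofSymbol (y i)) (φ i)) (fun g i hi hm => ⟨_, rfl, ?_⟩) hm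
        have h₁ : Provable (imp (g i) (or (and (ofSymbol (y i)) (φ i))
            (and (ofSymbol (y i)) (neg (φ i))))) := by
          rw [hi]
          exact .of_val fun v hv => by simp only [hv.imp, hv.and, hv.or, hv.neg]; tauto
        have h₂ := (Provable.app_update_mono σ g i h₁).imp_trans (.app_update_or σ g i _ _)
        rw [Function.update_eq_self] at h₂
        -- The alternative puts ¬φᵢ in the world of yᵢ. This also shows that world to be nonempty,
        -- so the induction hypothesis applies and contradicts satisfaction of φᵢ there.
        refine ((hU.or _ _).1 (hU.mem h₂ hm)).resolve_right fun h => ?_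
        have h₃ : neg (φ i) ∈ World A (y i) := mem_world_of_step (i := i) hA h (by
          rw [Function.update_self]
          exact .imp_refl _)
        have hne : (World A (y i)).Nonempty := ⟨_, h₃⟩
        exact ((ultra_world hvar hA hne).neg _).1 h₃ ((ih (hd i) hne).1 (hs i))
      · intro h
        obtain ⟨y, hy⟩ := world_successor hvar hA hw h
        refine ⟨fun i => canonicalWorld hvar A (.var (y i)), ⟨fun i => .var (y i), fun i => rfl,
          world_mono hA (.app_mono fun i => ?_) hy⟩, fun i => ?_⟩
        · exact .of_val fun v hv => by simp only [hv.imp, hv.and, ofSymbol]; tauto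
        · have hm : φ i ∈ World A (.var (y i)) := mem_world_of_step hA hy (.imp_refl _)
          exact (ih (hd i) ⟨_, hm⟩).2 hm
    | @all _ r x φ =>
      have hd : depth φ < n := Nat.lt_of_succ_lt_succ hφ
      have hsub : ∀ {ψ : Form L t} {u : StateSymbol L r}, depth ψ < n → Substitutable x u ψ →
          (Sat _ (Function.update (canonicalAssignment hvar A) ⟨r, x⟩ (canonicalWorld hvar A u))
            (canonicalWorld hvar A z) ψ ↔ subst x u ψ ∈ World A z) := by
        intro ψ u hψ hu
        have h := sat_subst hu (g := canonicalAssignment hvar A) (w := canonicalWorld hvar A z)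
        rw [val_canonical] at h
        exact h.symm.trans (ih (by rwa [depth_subst]) hz)
      rw [sat_all_iff_update]
      constructor
      · intro h
        by_contra hn
        have h₁ : Provable (imp (neg (all x φ)) (ex x (neg φ))) :=
          (Provable.all_mono x (φ := neg (neg φ)) (ψ := φ) (.of_val fun v hv => by
            simp only [hv.imp, hv.neg]; tauto)).contrapose
        obtain ⟨y, hy, hm⟩ := world_witness hvar hA hw (hU.mem h₁ ((hU.neg _).2 hn))
        refine (hU.neg _).1 hm ((hsub hd ?_).1 (h _))
        exact substitutable_of_not_isBound fun y' e => by cases e; exact hy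
      · rintro h ⟨_, u, rfl⟩
        -- The name u of the chosen world is arbitrary and might be captured in φ; an equivalent φ'
        -- of the same depth avoids this.
        obtain ⟨φ', hp, hd', hu, hs⟩ : ∃ φ' : Form L t, Provable (iff φ φ') ∧
            depth φ' = depth φ ∧ (∀ y, u = .var y → ¬ IsBound ⟨r, y⟩ φ') ∧
            ∀ (M : Model L) (g : Assignment M) (w : M.W t), Sat M g w φ' ↔ Sat M g w φ := by
          cases u with
          | nom j => exact ⟨φ, .iff_intro (.imp_refl φ) (.imp_refl φ), rfl,
              fun y e => (by cases e), fun _ _ _ => Iff.rfl⟩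
          | var y =>
            obtain ⟨φ', hp, hd', hb, hs⟩ := exists_alpha hvar φ ⟨r, y⟩
            exact ⟨φ', hp, hd', fun y' e => (by cases e; exact hb), hs⟩
        have hu' : Substitutable x u φ' := substitutable_of_not_isBound hu
        exact (hs _ _ _).1 ((hsub (hd'.trans_lt hd) hu').2
          (hU.mem ((Provable.all_mono x hp.iff_mp).imp_trans (.Q2 x u φ' hu')) h))

end Canonical

/-! ### Satisfiability of consistent sets -/

theorem satisfiable_of_roomy {L : Language.{u}} (hcount : L.IsCountable)
    (hvar : ∀ s : L.S, Infinite (L.SVAR s)) {s : L.S} {Γ : Set (Form L s)} (hΓ : Consistent Γ)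
    (hr : Roomy Γ) : Satisfiable Γ := by
  obtain ⟨A, hΓA, hA, hw⟩ := exists_ultra hcount hΓ hr
  have := hvar s
  obtain ⟨x⟩ := (inferInstance : Nonempty (L.SVAR s))
  -- The witness for ∃x x names the root, so A is contained in the world of y.
  obtain ⟨y, -, hy⟩ := hw x _ (hA.mem_of_provable (.name x))
  rw [subst_svar_self] at hy
  refine ⟨canonicalModel hvar A, canonicalAssignment hvar A, canonicalWorld hvar A (.var y),
    fun φ hφ => ?_⟩
  have hm : φ ∈ World A (.var y) := mem_world_root hA hy (hΓA hφ)
  exact (sat_canonical_iff hvar hA hw _ (Nat.lt_succ_self _) ⟨φ, hm⟩).2 hm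

end HybridForall

theorem mainTheorem4 (L : HybridForall.Language.{u}) (hcount : L.IsCountable)
    (hvar : ∀ s : L.S, Infinite (L.SVAR s)) (s : L.S) (Γ : Set (HybridForall.Form L s))
    (hΓ : HybridForall.Consistent Γ) : HybridForall.Satisfiable Γ := by
  obtain ⟨ρ, hρ, hfree, hcon⟩ := HybridForall.exists_rename_consistent hcount hvar hΓ
  refine .of_rename hρ (HybridForall.satisfiable_of_roomy hcount hvar hcon fun t => ?_)
  refine (hfree t).mono fun x (hx : x ∉ Set.range (ρ t)) γ hγ h => hx ?_
  obtain ⟨φ, -, rfl⟩ := hγ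
  obtain ⟨⟨r, w⟩, hw⟩ := HybridForall.Form.occurs_rename h
  cases hw
  exact ⟨w, rfl⟩
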